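/- Let $\Lambda$ be the ring of symmetric functions in $x=(x_1,x_2,\dots)$ with Schur functions $s_\lambda$, and let $\langle\cdot,\cdot\rangle$ be the Hall inner product, extended bilinearly to $\Lambda[q]$. Let $P_\lambda=P_\lambda(x;q)$ be the Hall–Littlewood functions, and let $Q'_\mu=Q'_\mu(x;q)$ be the dual basis of $\Lambda[q]$, so that $\langle P_\lambda,Q'_\mu\rangle=\delta_{\lambda\mu}$. The Kostka–Foulkes polynomials $K_{\lambda\mu}(q)$ are defined by $Q'_\mu=\sum_\lambda K_{\lambda\mu}(q)\,s_\lambda$, and the cocharge Kostka–Foulkes polynomials by $\tilde K_{\lambda\mu}(q)=q^{n(\mu)}K_{\lambda\mu}(1/q)$, where $n(\mu)=\sum_{i\ge1}(i-1)\mu_i$. **Theorem.** Let $\lambda=(\lambda_1,\lambda_2)$ with $\lambda_1\ge\lambda_2\ge0$ be a partition of length at most $2$, and let $\mu=(\mu_1\ge\dots\ge\mu_n>0)$ be a partition of length $n\ge 2$. Let $\mu^-=(\mu_1,\dots,\mu_{n-2},\mu_{n-1}-\mu_n,0)$, and let $\mu^+$ be the partition obtained by sorting $(\mu_1,\dots,\mu_{n-2},\mu_{n-1}+1,\mu_n-1)$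 into weakly decreasing order. Then $$\tilde K_{\lambda\mu}(q)=\tilde K_{\lambda\mu^+}(q)+q^{(n-1)\mu_n}\,\tilde K_{(\lambda_1-\mu_n,\,\lambda_2-\mu_n),\,\mu^-}(q),$$ where the last polynomial is understood to be $0$ if $\lambda_2<\mu_n$. -/

import Mathlib

/-!
Partitions are Young diagrams: the partition `μ` has parts `μ.rowLen 0 ≥ μ.rowLen 1 ≥ ⋯`
(so the part usually written `μ_i` is `μ.rowLen (i - 1)`), its length is `μ.colLen 0`.
Symmetric functions are power series in the variables `x_0, x_1, x_2, …`.
-/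

namespace KostkaFoulkes

noncomputable section

open scoped Polynomial LaurentPolynomial

/-! ### The module of symmetric functions over a commutative ring -/

/-- A power series has bounded degree if the degrees of its monomials are bounded. -/
def BoundedDegree {R : Type*} [CommRing R] (f : MvPowerSeries ℕ R) : Prop :=
  ∃ d : ℕ, ∀ α : ℕ →₀ ℕ, MvPowerSeries.coeff α f ≠ 0 → α.degree ≤ d

/-- The ring `Λ_R` of symmetric functions over `R`: the formal power series of bounded degree in
`x_0, x_1, …` that are invariant under all permutations of the variables. -/
def symFun (R : Type*) [CommRing R] : Subalgebra R (MvPowerSeries ℕ R) where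
  carrier := {f | BoundedDegree f ∧
    ∀ e : Equiv.Perm ℕ, MvPowerSeries.renameEquiv R e f = f}
  mul_mem' := by
    rintro f g ⟨⟨a, ha⟩, hf⟩ ⟨⟨b, hb⟩, hg⟩
    refine ⟨⟨a + b, fun α hα => ?_⟩, fun e => by rw [map_mul, hf, hg]⟩
    classical
    rw [MvPowerSeries.coeff_mul] at hα
    obtain ⟨p, hp, hne⟩ := Finset.exists_ne_zero_of_sum_ne_zero hα
    have h1 := ha p.1 (left_ne_zero_of_mul hne)
    have h2 := hb p.2 (right_ne_zero_of_mul hne)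
    rw [Finset.HasAntidiagonal.mem_antidiagonal] at hp
    rw [← hp, map_add]
    omega
  add_mem' := by
    rintro f g ⟨⟨a, ha⟩, hf⟩ ⟨⟨b, hb⟩, hg⟩
    refine ⟨⟨a + b, fun α hα => ?_⟩, fun e => by rw [map_add, hf, hg]⟩
    by_cases h : MvPowerSeries.coeff α f = 0
    · have h2 := hb α (by rw [map_add, h, zero_add] at hα; exact hα)
      omega
    · have h1 := ha α h
      omega
  algebraMap_mem' := by
    intro r
    refine ⟨⟨0, fun α hα => ?_⟩, fun e => AlgEquiv.commutes _ r⟩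
    classical
    rw [MvPowerSeries.algebraMap_apply, MvPowerSeries.coeff_C] at hα
    have : α = 0 := by
      by_contra h
      exact hα (if_neg h)
    simp [this]

/-- A power series of bounded degree whose coefficients only depend on the exponents up to
permutation of the variables is a symmetric function. -/
theorem mem_symFun_of_coeff {R : Type*} [CommRing R] {f : MvPowerSeries ℕ R}
    (hb : BoundedDegree f)
    (hs : ∀ (e : Equiv.Perm ℕ) (α : ℕ →₀ ℕ),
      MvPowerSeries.coeff (α.mapDomain e) f = MvPowerSeries.coeff α f) :
    f ∈ symFun R := by
  refine ⟨hb, fun e => ?_⟩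
  ext α
  have h := MvPowerSeries.coeff_embDomain_rename (R := R) e.toEmbedding f (α.mapDomain e.symm)
  have h1 : Finsupp.embDomain e.toEmbedding (α.mapDomain e.symm) = α := by
    rw [Finsupp.embDomain_eq_mapDomain]
    change Finsupp.mapDomain e (Finsupp.mapDomain e.symm α) = α
    rw [← Finsupp.mapDomain_comp]
    simp
  rw [h1, hs] at h
  exact h

/-- The complete homogeneous symmetric function `h_r`, the sum of all monomials of degree `r`. -/
def completeH (R : Type*) [CommRing R] (r : ℕ) : symFun R :=
  ⟨fun α => if α.degree = r then 1 else 0, by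
    have hc : ∀ α : ℕ →₀ ℕ, MvPowerSeries.coeff α
        ((fun α => if α.degree = r then 1 else 0 : MvPowerSeries ℕ R))
          = if α.degree = r then 1 else 0 := fun α => rfl
    refine mem_symFun_of_coeff ⟨r, fun α hα => ?_⟩ fun e α => ?_
    · rw [hc] at hα
      by_contra h
      exact hα (if_neg (by omega))
    · rw [hc, hc, Finsupp.degree_mapDomain]⟩

/-- `h_λ = h_{λ_1} h_{λ_2} ⋯`. -/
def completeHProd (R : Type*) [CommRing R] (lam : YoungDiagram) : symFun R :=
  ∏ i ∈ Finset.range (lam.colLen 0), completeH R (lam.rowLen i)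

/-- A partition as an exponent vector: `λ ↦ (λ_1, λ_2, …, 0, 0, …)`. -/
def expVec (lam : YoungDiagram) : ℕ →₀ ℕ :=
  Finsupp.onFinset (Finset.range (lam.colLen 0)) lam.rowLen (by
    intro i hi
    rw [Finset.mem_range, ← YoungDiagram.mem_iff_lt_colLen, YoungDiagram.mem_iff_lt_rowLen]
    omega)

open Classical in
/-- The monomial symmetric function `m_λ`: the sum of all distinct monomials whose exponent vector
is a rearrangement of `λ`. -/
def monomialSym (R : Type*) [CommRing R] (lam : YoungDiagram) : symFun R :=
  ⟨fun α => if ∃ e : Equiv.Perm ℕ, (expVec lam).mapDomain e = α then 1 else 0, by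
    have hc : ∀ α : ℕ →₀ ℕ, MvPowerSeries.coeff α
        ((fun α => if ∃ e : Equiv.Perm ℕ, (expVec lam).mapDomain e = α then 1 else 0 :
          MvPowerSeries ℕ R))
          = if ∃ e : Equiv.Perm ℕ, (expVec lam).mapDomain e = α then 1 else 0 := fun α => rfl
    refine mem_symFun_of_coeff ⟨(expVec lam).degree, fun α hα => ?_⟩ fun e α => ?_
    · rw [hc] at hα
      by_cases h : ∃ e : Equiv.Perm ℕ, (expVec lam).mapDomain e = α
      · obtain ⟨e, rfl⟩ := h
        rw [Finsupp.degree_mapDomain]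
      · exact absurd (if_neg h) hα
    · rw [hc, hc]
      refine if_congr ⟨?_, ?_⟩ rfl rfl
      · rintro ⟨e', h⟩
        refine ⟨e'.trans e.symm, ?_⟩
        have h2 := congrArg (Finsupp.mapDomain e.symm) h
        rw [← Finsupp.mapDomain_comp, ← Finsupp.mapDomain_comp] at h2
        simpa using h2
      · rintro ⟨e', h⟩
        refine ⟨e'.trans e, ?_⟩
        rw [← h, ← Finsupp.mapDomain_comp]
        rfl⟩

/-- The Schur function `s_λ`, the generating function of semistandard Young tableaux of shape `λ`:
the coefficient of `x^α` is the number of such tableaux in which every `k` occurs `α k` times. -/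
def schur (R : Type*) [CommRing R] (lam : YoungDiagram) : MvPowerSeries ℕ R :=
  fun α => (Set.ncard {T : SemistandardYoungTableau lam |
    ∀ k : ℕ, (lam.cells.filter fun c => T c.1 c.2 = k).card = α k} : R)

open Classical in
/-- The defining property of the Hall inner product: `⟨h_λ, m_μ⟩ = δ_{λμ}`. -/
def IsHallInner {R : Type*} [CommRing R] (B : LinearMap.BilinForm R (symFun R)) : Prop :=
  ∀ lam mu : YoungDiagram,
    B (completeHProd R lam) (monomialSym R mu) = if lam = mu then 1 else 0

open Classical in
/-- The Hall inner product on `Λ_R`, that is, the `R`-bilinear form with `⟨h_λ, m_μ⟩ = δ_{λμ}`.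
It exists and is unique since the `h_λ` and the `m_μ` are two bases of `Λ_R`. -/
def hallInner (R : Type*) [CommRing R] : LinearMap.BilinForm R (symFun R) :=
  if h : ∃ B : LinearMap.BilinForm R (symFun R), IsHallInner B then h.choose else 0

/-! ### Hall–Littlewood functions; the parameter `q` is the variable of `ℤ[q] = ℤ[X]` -/

/-- `v_m(q) = ∏_{j=1}^m (1 - q^j) / (1 - q) = ∏_{j=1}^m (1 + q + ⋯ + q^{j-1})`. -/
def vPoly (m : ℕ) : ℤ[X] :=
  ∏ j ∈ Finset.range m, ∑ k ∈ Finset.range (j + 1), Polynomial.X ^ k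

/-- `v_λ(q) = ∏_{i ≥ 0} v_{m_i}(q)`, where `m_i` is the number of entries equal to `i` in
`(λ_1, …, λ_N)` (zeros included). -/
def vPart (N : ℕ) (lam : YoungDiagram) : ℤ[X] :=
  ∏ i ∈ Finset.range (lam.rowLen 0 + 1),
    vPoly (Finset.univ.filter fun r : Fin N => lam.rowLen r = i).card

/-- The field of rational functions in `N` variables `x_0, …, x_{N-1}` and `q`. -/
abbrev RatFun (N : ℕ) : Type := FractionRing (MvPolynomial (Fin N) ℤ[X])

/-- The variable `x_i` as a rational function. -/
def ratX {N : ℕ} (i : Fin N) : RatFun N :=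
  algebraMap (MvPolynomial (Fin N) ℤ[X]) (RatFun N) (MvPolynomial.X i)

/-- A polynomial in `q` as a rational function. -/
def ratC (N : ℕ) (c : ℤ[X]) : RatFun N :=
  algebraMap (MvPolynomial (Fin N) ℤ[X]) (RatFun N) (MvPolynomial.C c)

/-- The Hall–Littlewood polynomial in `N ≥ ℓ(λ)` variables,
`P_λ(x_1, …, x_N; q) = v_λ(q)⁻¹ ∑_{w ∈ S_N} w(x^λ ∏_{i < j} (x_i - q x_j) / (x_i - x_j))`,
as a rational function. -/
def hallLittlewoodRat (N : ℕ) (lam : YoungDiagram) : RatFun N :=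
  (∑ w : Equiv.Perm (Fin N),
    (∏ i : Fin N, ratX (w i) ^ lam.rowLen i) *
      ∏ p ∈ Finset.univ.filter (fun p : Fin N × Fin N => p.1 < p.2),
        (ratX (w p.1) - ratC N Polynomial.X * ratX (w p.2)) / (ratX (w p.1) - ratX (w p.2)))
  / ratC N (vPart N lam)

/-- `f` is the Hall–Littlewood function `P_λ(x; q)` in infinitely many variables: for every
`N ≥ ℓ(λ)`, setting `x_N = x_{N+1} = ⋯ = 0` in `f` gives the polynomial
`P_λ(x_0, …, x_{N-1}; q)`. -/
def IsHallLittlewoodP (lam : YoungDiagram) (f : symFun ℤ[X]) : Prop :=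
  ∀ N : ℕ, lam.colLen 0 ≤ N → ∃ p : MvPolynomial (Fin N) ℤ[X],
    algebraMap (MvPolynomial (Fin N) ℤ[X]) (RatFun N) p = hallLittlewoodRat N lam ∧
    ∀ α : Fin N →₀ ℕ,
      MvPowerSeries.coeff (α.mapDomain (Fin.val : Fin N → ℕ)) (f : MvPowerSeries ℕ ℤ[X])
        = MvPolynomial.coeff α p

open Classical in
/-- The Hall–Littlewood functions `P_λ(x; q) ∈ Λ[q]` (they exist since the Hall–Littlewood
polynomials are symmetric polynomials and stable in the number of variables). -/
def hallLittlewoodP : YoungDiagram → symFun ℤ[X] :=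
  if h : ∃ P : YoungDiagram → symFun ℤ[X], ∀ lam, IsHallLittlewoodP lam (P lam)
  then h.choose else 0

open Classical in
/-- `Q` is dual to the Hall–Littlewood functions: `⟨P_λ, Q_μ⟩ = δ_{λμ}`. -/
def IsDualToP (Q : YoungDiagram → symFun ℤ[X]) : Prop :=
  ∀ lam mu : YoungDiagram,
    hallInner ℤ[X] (hallLittlewoodP lam) (Q mu) = if lam = mu then 1 else 0

open Classical in
/-- The modified Hall–Littlewood functions `Q'_μ(x; q)`, the basis of `Λ[q]` dual to the `P_λ`
with respect to the Hall inner product. -/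
def modifiedHL : YoungDiagram → symFun ℤ[X] :=
  if h : ∃ Q : YoungDiagram → symFun ℤ[X], IsDualToP Q then h.choose else 0

/-! ### Kostka–Foulkes polynomials -/

/-- `K μ λ`, for all `λ` and `μ`, are the coefficients in `Q'_μ = ∑_λ K_{λμ}(q) s_λ`. -/
def IsKostkaFoulkes (K : YoungDiagram → YoungDiagram →₀ ℤ[X]) : Prop :=
  ∀ mu : YoungDiagram, (modifiedHL mu : MvPowerSeries ℕ ℤ[X])
    = (K mu).sum fun lam c => c • schur ℤ[X] lam

open Classical in
/-- The Kostka–Foulkes polynomial `K_{λμ}(q)`, defined by `Q'_μ = ∑_λ K_{λμ}(q) s_λ`. It is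
unique since the Schur functions are a basis of `Λ[q]`. -/
def kostkaFoulkes (lam mu : YoungDiagram) : ℤ[X] :=
  if h : ∃ K : YoungDiagram → YoungDiagram →₀ ℤ[X], IsKostkaFoulkes K
  then h.choose mu lam else 0

/-- `n(μ) = ∑_{i ≥ 1} (i - 1) μ_i`. -/
def nStat (mu : YoungDiagram) : ℕ := ∑ i ∈ Finset.range (mu.colLen 0), i * mu.rowLen i

/-- The cocharge Kostka–Foulkes polynomial `q^{n(μ)} K_{λμ}(1/q)`, in `ℤ[q, q⁻¹]`. -/
def cochargeKostka (lam mu : YoungDiagram) : ℤ[T;T⁻¹] :=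
  LaurentPolynomial.T (nStat mu : ℤ) *
    LaurentPolynomial.invert (Polynomial.toLaurent (kostkaFoulkes lam mu))

/-! ### The operations on partitions -/

/-- The partition obtained by sorting a list of nonnegative integers (and dropping zeros). -/
def sortedPartition (l : List ℕ) : YoungDiagram :=
  YoungDiagram.ofRowLens (l.insertionSort (· ≥ ·))
    (List.Pairwise.sortedGE (List.pairwise_insertionSort (· ≥ ·) l))

/-- The last part `μ_n`, where `n` is the length of `μ`. -/
def lastPart (mu : YoungDiagram) : ℕ := mu.rowLen (mu.colLen 0 - 1)

/-- `μ⁻ = (μ_1, …, μ_{n-2}, μ_{n-1} - μ_n, 0)`, where `n ≥ 2` is the length of `μ`. -/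
def muMinus (mu : YoungDiagram) : YoungDiagram :=
  sortedPartition ((List.range (mu.colLen 0 - 2)).map mu.rowLen ++
    [mu.rowLen (mu.colLen 0 - 2) - lastPart mu, 0])

/-- `μ⁺` is the sorted rearrangement of `(μ_1, …, μ_{n-2}, μ_{n-1} + 1, μ_n - 1)`, where `n ≥ 2`
is the length of `μ`. -/
def muPlus (mu : YoungDiagram) : YoungDiagram :=
  sortedPartition ((List.range (mu.colLen 0 - 2)).map mu.rowLen ++
    [mu.rowLen (mu.colLen 0 - 2) + 1, lastPart mu - 1])

/-- The cocharge Kostka–Foulkes polynomial indexed by a pair of integers `(a, b)` in place of `λ`;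
it is `0` unless `a ≥ b ≥ 0`, that is, unless `(a, b)` is a partition. -/
def cochargeKostkaPair (a b : ℤ) (mu : YoungDiagram) : ℤ[T;T⁻¹] :=
  if 0 ≤ b ∧ b ≤ a then cochargeKostka (sortedPartition [a.toNat, b.toNat]) mu else 0

end

end KostkaFoulkes

/-! For λ with at most two rows, only the specialization of `Q'_μ` to two variables matters, and
there everything is explicit. Let H_μ(y₁, y₂) be the coefficient of x^μ in ∏_i 1/((1 - x_i y₁)(1 -
x_i y₂)) · ∏_{a<b} (1 - x_b/x_a)/(1 - q x_b/x_a) (`twoVar`, `listHL`), for an arbitrary sequence μ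
of parts. Partial fractions in the first variable give (y₁ - y₂) H_{(m,μ)}(y₁, y₂) = y₁^{m+1} H_μ(q
y₁, y₂) - y₂^{m+1} H_μ(y₁, q y₂) (`sub_mul_twoVar_cons`), which determines H. Two relations follow:
H(…, r, r+1, …) = q H(…, r+1, r, …) (`listHL_exchange`), and H(l, a, b) = q H(l, a+1, b-1) + q^{|l|
b} (y₁y₂)^b H(l, a-b) (`listHL_append_pair`); the latter is an identity for two parts, and each
prepended part multiplies y₁y₂ by q. Sorting (l, a+1, b-1) costs a power of q equal to the drop of
the statistic n (`straightens_insertionSort`), multiplication by (y₁y₂)^b shifts a two-row λ by (b,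
b), and passing to cocharge turns the powers of q into those of the theorem.

That H_μ is `Q'_μ` in two variables is a matter of duality. The functional "coefficient of x^μ in f
∏_{a<b} (1 - x_b/x_a)/(1 - q x_b/x_a)" is dual to the Hall–Littlewood polynomials
(`hlCoeff_hallLittlewood`). Applied to h_a h_b it therefore yields the coefficient of `P_μ`, which
is also ⟨h_a h_b, Q'_μ⟩, the coefficient of y₁^a y₂^b in `Q'_μ` (`coeff_dual_eq_twoVar`). The
coefficient of s_λ is then a difference of two such coefficients.

The objects defined by choice need not be constructed: if a needed one did not exist, all the
polynomials involved would be 0 and the theorem would read 0 = 0 (`kostkaFoulkes_twoRow`). -/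

namespace KostkaFoulkes

noncomputable section

open MvPowerSeries

variable {σ B : Type*} [CommRing B] {N : ℕ}

/-! ### Geometric series -/

/-- The series `1 / (1 - z)`. -/
def geom (z : MvPowerSeries σ B) : MvPowerSeries σ B := invOfUnit (1 - z) 1

theorem mul_geom {z : MvPowerSeries σ B} (hz : constantCoeff z = 0) : (1 - z) * geom z = 1 :=
  mul_invOfUnit _ _ (by simp [hz])

theorem eq_of_mul_eq_one {R : Type*} [CommRing R] {u v w : R} (h : u * v = 1) (h' : u * w = 1) :
    v = w := by
  calc v = v * (u * w) := by rw [h', mul_one]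
    _ = w * (u * v) := by ring
    _ = w := by rw [h, mul_one]

/-- A geometric series is pinned down by an algebraic equation, so any ring homomorphism carries it
along and no continuity has to be checked. -/
theorem ringHom_geom {τ B' : Type*} [CommRing B'] (f : MvPowerSeries σ B →+* MvPowerSeries τ B')
    {z : MvPowerSeries σ B} (hz : constantCoeff z = 0) (hfz : constantCoeff (f z) = 0) :
    f (geom z) = geom (f z) := by
  refine eq_of_mul_eq_one (u := 1 - f z) ?_ (mul_geom hfz)
  rw [← map_one f, ← map_sub, ← map_mul, mul_geom hz]

/-! ### Decomposing a power series by weight -/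

/-- The part of weight `k` of a power series. -/
def weightPart (w : (σ →₀ ℕ) →+ ℕ) (k : ℕ) (F : MvPowerSeries σ B) : MvPowerSeries σ B :=
  fun e => if w e = k then coeff e F else 0

theorem coeff_weightPart (w : (σ →₀ ℕ) →+ ℕ) (k : ℕ) (F : MvPowerSeries σ B) (e : σ →₀ ℕ) :
    coeff e (weightPart w k F) = if w e = k then coeff e F else 0 := rfl

/-- The ring homomorphism `F ↦ ∑ F_k X^k`, where `F_k` is the part of `F` of weight `k`. -/
def homogenize (w : (σ →₀ ℕ) →+ ℕ) : MvPowerSeries σ B →+* PowerSeries (MvPowerSeries σ B) where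
  toFun F := PowerSeries.mk fun k => weightPart w k F
  map_one' := by
    classical
    ext k e
    rw [PowerSeries.coeff_mk, coeff_weightPart, PowerSeries.coeff_one]
    by_cases hk : k = 0
    · subst hk
      rw [if_pos rfl, coeff_one]
      by_cases he : e = 0 <;> simp [he]
    · rw [if_neg hk, coeff_one]
      by_cases he : e = 0
      · simp [he, Ne.symm hk]
      · simp [he]
  map_mul' F G := by
    classical
    ext k e
    rw [PowerSeries.coeff_mk, coeff_weightPart, PowerSeries.coeff_mul, map_sum]
    simp only [coeff_mul, PowerSeries.coeff_mk]
    rw [Finset.sum_comm]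
    split_ifs with h
    · refine Finset.sum_congr rfl fun p hp => ?_
      rw [Finset.HasAntidiagonal.mem_antidiagonal] at hp
      rw [Finset.sum_eq_single (w p.1, w p.2)]
      · simp [coeff_weightPart]
      · intro x _ hx
        simp only [coeff_weightPart]
        by_cases h1 : w p.1 = x.1
        · rw [if_neg (c := w p.2 = x.2), mul_zero]
          intro h2
          exact hx (Prod.ext h1.symm h2.symm)
        · rw [if_neg h1, zero_mul]
      · intro hx
        exfalso
        apply hx
        rw [Finset.HasAntidiagonal.mem_antidiagonal, ← map_add, hp, h]
    · symm
      refine Finset.sum_eq_zero fun p hp => Finset.sum_eq_zero fun x hx => ?_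
      rw [Finset.HasAntidiagonal.mem_antidiagonal] at hp hx
      simp only [coeff_weightPart]
      by_cases h1 : w p.1 = x.1
      · rw [if_neg (c := w p.2 = x.2), mul_zero]
        intro h2
        apply h
        rw [← hp, map_add, h1, h2, hx]
      · rw [if_neg h1, zero_mul]
  map_zero' := by
    ext k e
    simp [coeff_weightPart]
  map_add' F G := by
    ext k e
    simp only [PowerSeries.coeff_mk, map_add, coeff_weightPart]
    split_ifs <;> simp

theorem coeff_homogenize (w : (σ →₀ ℕ) →+ ℕ) (F : MvPowerSeries σ B) (k : ℕ) :
    PowerSeries.coeff k (homogenize w F) = weightPart w k F := by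
  simp [homogenize]

theorem coeff_coeff_homogenize (w : (σ →₀ ℕ) →+ ℕ) (F : MvPowerSeries σ B) (k : ℕ) (e : σ →₀ ℕ) :
    coeff e (PowerSeries.coeff k (homogenize w F)) = if w e = k then coeff e F else 0 := by
  rw [coeff_homogenize, coeff_weightPart]

theorem homogenize_monomial (w : (σ →₀ ℕ) →+ ℕ) (e : σ →₀ ℕ) (c : B) :
    homogenize w (monomial e c) = PowerSeries.X ^ w e * PowerSeries.C (monomial e c) := by
  classical
  ext k e'
  rw [coeff_coeff_homogenize, PowerSeries.coeff_mul_C, PowerSeries.coeff_X_pow, coeff_monomial,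
    ite_mul, one_mul, zero_mul, apply_ite (coeff e'), coeff_monomial, map_zero]
  by_cases he : e' = e
  · subst he
    simp [eq_comm]
  · simp [he]

/-! ### The variables -/

/-- The variable `x_i = T_0 T_1 ⋯ T_i` in coordinates `T`. -/
def xv (B : Type*) [CommRing B] {N : ℕ} (i : Fin N) : MvPowerSeries (Fin N) B :=
  ∏ k, if k ≤ i then X k else 1

/-- The ratio `x_b / x_a = T_{a+1} ⋯ T_b`, for `a ≤ b`. -/
def tv (B : Type*) [CommRing B] {N : ℕ} (a b : Fin N) : MvPowerSeries (Fin N) B :=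
  ∏ k, if a < k ∧ k ≤ b then X k else 1

/-- The degree in the variables `x_i`, which is the exponent of `T_0`. -/
def xdeg (N : ℕ) : (Fin N →₀ ℕ) →+ ℕ where
  toFun e := ∑ i : Fin N, if (i : ℕ) = 0 then e i else 0
  map_zero' := by simp
  map_add' e e' := by
    rw [← Finset.sum_add_distrib]
    refine Finset.sum_congr rfl fun i _ => ?_
    split_ifs <;> simp

/-- The exponent in coordinates `T` of the monomial `x^μ`. -/
def tail (μ : Fin N → ℕ) : Fin N →₀ ℕ :=
  Finsupp.equivFunOnFinite.symm fun k => ∑ i, if k ≤ i then μ i else 0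

theorem tail_apply (μ : Fin N → ℕ) (k : Fin N) : tail μ k = ∑ i, if k ≤ i then μ i else 0 := rfl

theorem xdeg_tail (μ : Fin N → ℕ) : xdeg N (tail μ) = ∑ i, μ i := by
  change (∑ i : Fin N, if (i : ℕ) = 0 then tail μ i else 0) = _
  cases N with
  | zero => simp
  | succ N =>
    rw [Fin.sum_univ_succ]
    simp [tail_apply]

/-- The exponent of `T_0` in x^μ is the total degree, and the other exponents do not see the first
part. This is what makes recursion on the first part possible. -/
theorem tail_cons (m : ℕ) (μ : Fin N → ℕ) :
    tail (Fin.cons m μ : Fin (N + 1) → ℕ) = Finsupp.cons (m + ∑ i, μ i) (tail μ) := by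
  ext k
  refine Fin.cases ?_ (fun k => ?_) k
  · simp [tail_apply, Fin.sum_univ_succ]
  · simp [tail_apply, Fin.sum_univ_succ, Finsupp.cons_succ]

theorem finSuccEquiv_xv_zero :
    finSuccEquiv B N (xv B 0) = PowerSeries.X := by
  simp [xv, finSuccEquiv_X_zero]

/-- When `T_0 = x_0` is singled out, the remaining coordinates describe the ratios x'_i =
x_{i+1}/x_0, which play the role of the variables in one dimension less: x_{i+1} = x_0 x'_i. -/
theorem finSuccEquiv_xv_succ (i : Fin N) :
    finSuccEquiv B N (xv B i.succ) = PowerSeries.X * PowerSeries.C (xv B i) := by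
  simp only [xv, Fin.prod_univ_succ, map_mul, map_prod, Fin.zero_le, if_true, finSuccEquiv_X_zero,
    Fin.succ_le_succ_iff]
  congr 1
  refine Finset.prod_congr rfl fun k _ => ?_
  split_ifs <;> simp [finSuccEquiv_X_succ]

theorem finSuccEquiv_tv_zero_succ (j : Fin N) :
    finSuccEquiv B N (tv B 0 j.succ) = PowerSeries.C (xv B j) := by
  simp only [tv, xv, Fin.prod_univ_succ, map_prod, Fin.succ_le_succ_iff, lt_irrefl,
    false_and, if_false, one_mul, Fin.succ_pos, true_and]
  refine Finset.prod_congr rfl fun k _ => ?_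
  split_ifs <;> simp [finSuccEquiv_X_succ]

theorem finSuccEquiv_tv_succ_succ (i j : Fin N) :
    finSuccEquiv B N (tv B i.succ j.succ) = PowerSeries.C (tv B i j) := by
  simp only [tv, Fin.prod_univ_succ, map_prod, Fin.succ_le_succ_iff, Fin.not_lt_zero,
    false_and, if_false, one_mul, Fin.succ_lt_succ_iff]
  refine Finset.prod_congr rfl fun k _ => ?_
  split_ifs <;> simp [finSuccEquiv_X_succ]

theorem constantCoeff_xv (i : Fin N) : constantCoeff (xv B i) = 0 := by
  rw [xv, map_prod]
  exact Finset.prod_eq_zero (Finset.mem_univ i) (by simp)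

theorem constantCoeff_tv {a b : Fin N} (h : a < b) : constantCoeff (tv B a b) = 0 := by
  rw [tv, map_prod]
  exact Finset.prod_eq_zero (Finset.mem_univ b) (by simp [h])

theorem constantCoeff_C_mul_xv (c : B) (i : Fin N) : constantCoeff (C c * xv B i) = 0 := by
  rw [map_mul, constantCoeff_xv, mul_zero]

theorem constantCoeff_C_mul_tv (c : B) {a b : Fin N} (h : a < b) :
    constantCoeff (C c * tv B a b) = 0 := by
  rw [map_mul, constantCoeff_tv h, mul_zero]

theorem prod_X_eq_monomial (p : Fin N → Prop) [DecidablePred p] :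
    (∏ k, if p k then X k else 1 : MvPowerSeries (Fin N) B)
      = monomial (Finsupp.equivFunOnFinite.symm fun k => if p k then 1 else 0) 1 := by
  have h : (∏ k, if p k then X k else 1 : MvPowerSeries (Fin N) B)
      = ∏ k, monomial (Finsupp.single k (if p k then 1 else 0)) 1 := by
    refine Finset.prod_congr rfl fun k _ => ?_
    split_ifs
    · rfl
    · simp
  rw [h]
  have h2 : ∀ s : Finset (Fin N), (∏ k ∈ s, monomial (Finsupp.single k (if p k then 1 else 0)) 1 :
      MvPowerSeries (Fin N) B)
        = monomial (∑ k ∈ s, Finsupp.single k (if p k then 1 else 0)) 1 := by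
    intro s
    induction s using Finset.induction_on with
    | empty => simp
    | insert a s ha ih => rw [Finset.prod_insert ha, Finset.sum_insert ha, ih,
        monomial_mul_monomial, one_mul]
  rw [h2]
  congr 2
  ext k
  simp [Finsupp.finsetSum_apply, Finsupp.single_apply]

theorem homogenize_xv (i : Fin N) :
    homogenize (xdeg N) (xv B i) = PowerSeries.X * PowerSeries.C (xv B i) := by
  rw [xv, prod_X_eq_monomial, homogenize_monomial]
  congr 1
  conv_rhs => rw [← pow_one PowerSeries.X]
  congr 1
  change (∑ k : Fin N, if (k : ℕ) = 0 then (if k ≤ i then 1 else 0) else 0) = 1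
  cases N with
  | zero => exact i.elim0
  | succ N => simp

theorem homogenize_C (w : (σ →₀ ℕ) →+ ℕ) (c : B) :
    homogenize w (C c) = PowerSeries.C (C c) := by
  have := homogenize_monomial w 0 c
  rwa [map_zero, pow_zero, one_mul] at this

theorem ringHom_xv {B' : Type*} [CommRing B'] (f : B →+* B') (i : Fin N) :
    map f (xv B i) = xv B' i := by
  rw [xv, xv, map_prod]
  refine Finset.prod_congr rfl fun k _ => ?_
  split_ifs <;> simp

theorem ringHom_tv {B' : Type*} [CommRing B'] (f : B →+* B') (a b : Fin N) :
    map f (tv B a b) = tv B' a b := by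
  rw [tv, tv, map_prod]
  refine Finset.prod_congr rfl fun k _ => ?_
  split_ifs <;> simp

/-! ### The two-variable modified Hall–Littlewood polynomials -/

/-- The factor `(1 - x_b / x_a) / (1 - q x_b / x_a)`, for `a < b`. -/
def rootFactor (q : B) (a b : Fin N) : MvPowerSeries (Fin N) B :=
  if a < b then (1 - tv B a b) * geom (C q * tv B a b) else 1

/-- The product `∏_{a < b} (1 - x_b / x_a) / (1 - q x_b / x_a)`. -/
def weight (N : ℕ) (q : B) : MvPowerSeries (Fin N) B := ∏ a, ∏ b, rootFactor q a b

/-- The product `∏_i 1 / (1 - x_i y)`. -/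
def cauchy (N : ℕ) (y : B) : MvPowerSeries (Fin N) B := ∏ i, geom (C y * xv B i)

/-- The coefficient of `x^μ` in
`∏_i 1 / ((1 - x_i y₁) (1 - x_i y₂)) ∏_{a < b} (1 - x_b / x_a) / (1 - q x_b / x_a)`. -/
def twoVar (q y₁ y₂ : B) (μ : Fin N → ℕ) : B :=
  coeff (tail μ) (cauchy N y₁ * cauchy N y₂ * weight N q)

theorem map_cauchy {B' : Type*} [CommRing B'] (f : B →+* B') (y : B) :
    map f (cauchy N y) = cauchy N (f y) := by
  rw [cauchy, cauchy, map_prod]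
  refine Finset.prod_congr rfl fun i _ => ?_
  have h : map f (C y * xv B i) = C (f y) * xv B' i := by
    rw [map_mul, ringHom_xv, map_C]
  rw [ringHom_geom (map f) (constantCoeff_C_mul_xv y i)
    (by rw [h]; exact constantCoeff_C_mul_xv _ i), h]

theorem map_weight {B' : Type*} [CommRing B'] (f : B →+* B') (q : B) :
    map f (weight N q) = weight N (f q) := by
  rw [weight, weight, map_prod]
  refine Finset.prod_congr rfl fun a _ => ?_
  rw [map_prod]
  refine Finset.prod_congr rfl fun b _ => ?_
  rw [rootFactor, rootFactor]
  split_ifs with hab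
  · have h : map f (C q * tv B a b) = C (f q) * tv B' a b := by
      rw [map_mul, ringHom_tv, map_C]
    rw [map_mul, map_sub, map_one, ringHom_tv,
      ringHom_geom (map f) (constantCoeff_C_mul_tv q hab)
      (by rw [h]; exact constantCoeff_C_mul_tv _ hab), h]
  · exact map_one _

/-- Naturality in the coefficient ring lets the substitutions y_j ↦ q y_j be treated as ring
endomorphisms. -/
theorem map_twoVar {B' : Type*} [CommRing B'] (f : B →+* B') (q y₁ y₂ : B) (μ : Fin N → ℕ) :
    f (twoVar q y₁ y₂ μ) = twoVar (f q) (f y₁) (f y₂) μ := by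
  rw [twoVar, twoVar, ← coeff_map, map_mul (map f), map_mul (map f), map_cauchy, map_cauchy,
    map_weight]

/-! ### Scaling the variables -/

/-- The substitution `x_i ↦ y x_i`. -/
def scaleX (N : ℕ) (y : B) : MvPowerSeries (Fin N) B →+* MvPowerSeries (Fin N) B :=
  rescale fun i => if (i : ℕ) = 0 then y else 1

theorem coeff_scaleX (y : B) (F : MvPowerSeries (Fin N) B) (e : Fin N →₀ ℕ) :
    coeff e (scaleX N y F) = y ^ xdeg N e * coeff e F := by
  rw [scaleX, coeff_rescale]
  congr 1
  rw [Finsupp.prod_fintype _ _ (by simp)]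
  change _ = y ^ (∑ i : Fin N, if (i : ℕ) = 0 then e i else 0)
  rw [← Finset.prod_pow_eq_pow_sum]
  refine Finset.prod_congr rfl fun i _ => ?_
  split_ifs <;> simp

theorem scaleX_monomial (y c : B) (e : Fin N →₀ ℕ) :
    scaleX N y (monomial e c) = C (y ^ xdeg N e) * monomial e c := by
  classical
  ext e'
  rw [coeff_scaleX, coeff_C_mul, coeff_monomial]
  by_cases h : e' = e
  · subst h; rfl
  · simp [h]

theorem scaleX_xv (y : B) (i : Fin N) : scaleX N y (xv B i) = C y * xv B i := by
  rw [xv, prod_X_eq_monomial, scaleX_monomial]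
  congr 2
  conv_rhs => rw [← pow_one y]
  congr 1
  change (∑ k : Fin N, if (k : ℕ) = 0 then (if k ≤ i then 1 else 0) else 0) = 1
  cases N with
  | zero => exact i.elim0
  | succ N => simp

theorem scaleX_tv (y : B) (a b : Fin N) : scaleX N y (tv B a b) = tv B a b := by
  rw [tv, prod_X_eq_monomial, scaleX_monomial]
  conv_rhs => rw [← one_mul (monomial _ _)]
  congr 1
  rw [← map_one C, ← pow_zero y]
  congr 2
  change (∑ k : Fin N, if (k : ℕ) = 0 then (if a < k ∧ k ≤ b then 1 else 0) else 0) = 0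
  refine Finset.sum_eq_zero fun k _ => ?_
  have : (k : ℕ) = 0 → ¬ (a < k ∧ k ≤ b) := fun h h' => by
    have := h'.1
    rw [Fin.lt_def] at this
    omega
  split_ifs <;> simp_all

theorem scaleX_C (y c : B) : scaleX N y (C c) = C c := by
  have := scaleX_monomial y c (0 : Fin N →₀ ℕ)
  rwa [map_zero, pow_zero, map_one, one_mul] at this

theorem scaleX_geom_xv (y c : B) (i : Fin N) :
    scaleX N y (geom (C c * xv B i)) = geom (C (c * y) * xv B i) := by
  have h : scaleX N y (C c * xv B i) = C (c * y) * xv B i := by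
    rw [map_mul, scaleX_xv, scaleX_C, map_mul, mul_assoc]
  rw [ringHom_geom _ (constantCoeff_C_mul_xv c i) (by rw [h]; exact constantCoeff_C_mul_xv _ i), h]

/-- Only ratios of variables occur, and these have degree 0. -/
theorem scaleX_weight (y q : B) : scaleX N y (weight N q) = weight N q := by
  rw [weight, map_prod]
  refine Finset.prod_congr rfl fun a _ => ?_
  rw [map_prod]
  refine Finset.prod_congr rfl fun b _ => ?_
  rw [rootFactor]
  split_ifs with hab
  · have h : scaleX N y (C q * tv B a b) = C q * tv B a b := by
      rw [map_mul, scaleX_tv, scaleX_C]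
    rw [map_mul, map_sub, map_one, scaleX_tv, ringHom_geom _ (constantCoeff_C_mul_tv q hab)
      (by rw [h]; exact constantCoeff_C_mul_tv _ hab), h]
  · exact map_one _

/-! ### Peeling off the first variable -/

/-- In degree n the factor 1/(1 - yX) supplies y^{n-k} to the part of `F` of weight k. The bound
`hn` keeps the subtraction from truncating. -/
theorem coeff_coeff_geometric_mul_homogenize [DecidableEq σ] (w : (σ →₀ ℕ) →+ ℕ) (y : B)
    (F H : MvPowerSeries σ B) {n : ℕ} {e : σ →₀ ℕ} (hn : w e ≤ n) :
    coeff e (PowerSeries.coeff n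
      (PowerSeries.mk (fun k => (C y : MvPowerSeries σ B) ^ k) * homogenize w F * PowerSeries.C H))
      = ∑ p ∈ Finset.HasAntidiagonal.antidiagonal e, y ^ (n - w p.1) * (coeff p.1 F * coeff p.2 H) := by
  rw [PowerSeries.coeff_mul_C, PowerSeries.coeff_mul, coeff_mul]
  refine Finset.sum_congr rfl fun p hp => ?_
  rw [Finset.HasAntidiagonal.mem_antidiagonal] at hp
  rw [← mul_assoc]
  congr 1
  rw [map_sum, Finset.sum_eq_single (n - w p.1, w p.1)]
  · rw [PowerSeries.coeff_mk, ← map_pow, coeff_C_mul, coeff_coeff_homogenize, if_pos rfl]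
  · intro x hx hne
    rw [Finset.HasAntidiagonal.mem_antidiagonal] at hx
    rw [PowerSeries.coeff_mk, ← map_pow, coeff_C_mul, coeff_coeff_homogenize, if_neg, mul_zero]
    intro h
    exact hne (Prod.ext (by simp only; omega) h.symm)
  · intro hx
    exfalso
    apply hx
    rw [Finset.HasAntidiagonal.mem_antidiagonal]
    have : w p.1 ≤ w e := by rw [← hp, map_add]; omega
    simp only
    omega

theorem mk_pow_mul {R : Type*} [CommRing R] (y : R) :
    (1 - PowerSeries.X * PowerSeries.C y) * PowerSeries.mk (fun k => y ^ k) = 1 := by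
  ext n
  rw [sub_mul, one_mul, map_sub, mul_assoc]
  cases n with
  | zero => simp
  | succ n =>
    rw [PowerSeries.coeff_succ_X_mul, PowerSeries.coeff_C_mul]
    simp [PowerSeries.coeff_one, pow_succ']

theorem finSuccEquiv_geom_xv_zero (y : B) :
    finSuccEquiv B N (geom (C y * xv B 0)) = PowerSeries.mk fun k => C y ^ k := by
  refine eq_of_mul_eq_one (u := 1 - PowerSeries.X * PowerSeries.C (C y)) ?_ (mk_pow_mul _)
  have h := congrArg (finSuccEquiv B N) (mul_geom (constantCoeff_C_mul_xv y (0 : Fin (N + 1))))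
  rwa [map_mul, map_sub, map_mul, map_one, finSuccEquiv_C, finSuccEquiv_xv_zero, mul_comm _ PowerSeries.X] at h

theorem finSuccEquiv_geom_xv_succ (y : B) (i : Fin N) :
    finSuccEquiv B N (geom (C y * xv B i.succ)) = homogenize (xdeg N) (geom (C y * xv B i)) := by
  refine eq_of_mul_eq_one
    (u := 1 - PowerSeries.C (C y) * (PowerSeries.X * PowerSeries.C (xv B i))) ?_ ?_
  · have h := congrArg (finSuccEquiv B N) (mul_geom (constantCoeff_C_mul_xv y i.succ))
    rwa [map_mul, map_sub, map_mul, map_one, finSuccEquiv_C, finSuccEquiv_xv_succ] at h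
  · have h := congrArg (homogenize (xdeg N)) (mul_geom (constantCoeff_C_mul_xv y i))
    rwa [map_mul, map_sub, map_mul, map_one, homogenize_C, homogenize_xv] at h

/-- The first variable contributes 1/(1 - yX); every other one is X times a variable of the smaller
ring, so the rest of the product is graded by its degree. -/
theorem finSuccEquiv_cauchy (y : B) :
    finSuccEquiv B N (cauchy (N + 1) y)
      = PowerSeries.mk (fun k => C y ^ k) * homogenize (xdeg N) (cauchy N y) := by
  rw [cauchy, cauchy, Fin.prod_univ_succ, map_mul, map_prod, map_prod, finSuccEquiv_geom_xv_zero]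
  congr 1
  exact Finset.prod_congr rfl fun i _ => finSuccEquiv_geom_xv_succ y i

theorem finSuccEquiv_geom_tv (q : B) {a b : Fin (N + 1)} (h : a < b) {u : MvPowerSeries (Fin N) B}
    (hu : constantCoeff u = 0) (hab : finSuccEquiv B N (tv B a b) = PowerSeries.C u) :
    finSuccEquiv B N (geom (C q * tv B a b)) = PowerSeries.C (geom (C q * u)) := by
  refine eq_of_mul_eq_one (u := PowerSeries.C (1 - C q * u)) ?_ ?_
  · have h := congrArg (finSuccEquiv B N) (mul_geom (constantCoeff_C_mul_tv q h))
    rw [map_mul, map_sub, map_mul, map_one, finSuccEquiv_C, hab] at h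
    rwa [map_sub, map_mul, map_one]
  · rw [← map_mul, mul_geom (by rw [map_mul, hu, mul_zero]), map_one]

/-- All ratios are free of `T_0`, so the product is constant in X. Pairs containing the first index
become factors in the new variables themselves, and the others form the product in one dimension
less. -/
theorem finSuccEquiv_weight (q : B) :
    finSuccEquiv B N (weight (N + 1) q)
      = PowerSeries.C ((∏ j, (1 - xv B j) * geom (C q * xv B j)) * weight N q) := by
  rw [weight, Fin.prod_univ_succ, map_mul, map_mul, Fin.prod_univ_succ]
  congr 1
  · simp only [rootFactor, lt_irrefl, if_false, one_mul, Fin.succ_pos, if_true, map_prod, map_mul,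
      map_sub, map_one]
    refine Finset.prod_congr rfl fun j _ => ?_
    rw [finSuccEquiv_tv_zero_succ, finSuccEquiv_geom_tv q (Fin.succ_pos j) (constantCoeff_xv j)
      (finSuccEquiv_tv_zero_succ j)]
  · rw [weight, map_prod, map_prod]
    refine Finset.prod_congr rfl fun i _ => ?_
    rw [Fin.prod_univ_succ, map_mul, map_prod, map_prod, rootFactor, if_neg (Fin.not_lt_zero _),
      map_one, one_mul]
    refine Finset.prod_congr rfl fun j _ => ?_
    rw [rootFactor, rootFactor]
    by_cases hij : i < j
    · rw [if_pos (Fin.succ_lt_succ_iff.2 hij), if_pos hij, map_mul, map_sub, map_one,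
        finSuccEquiv_tv_succ_succ, finSuccEquiv_geom_tv q (Fin.succ_lt_succ_iff.2 hij)
          (constantCoeff_tv hij) (finSuccEquiv_tv_succ_succ i j), map_mul, map_sub, map_one]
    · rw [if_neg (fun h => hij (Fin.succ_lt_succ_iff.1 h)), if_neg hij, map_one, map_one]

/-- After scaling, the numerators 1 - y x_j cancel the Cauchy factor at y and the denominators form
the Cauchy factor at q y. This is the origin of the shift y ↦ q y. -/
theorem cauchy_mul_scaleX (q y : B) :
    cauchy N y * scaleX N y ((∏ j, (1 - xv B j) * geom (C q * xv B j)) * weight N q)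
      = cauchy N (q * y) * weight N q := by
  rw [map_mul, scaleX_weight, ← mul_assoc, cauchy, cauchy, map_prod, ← Finset.prod_mul_distrib]
  congr 1
  refine Finset.prod_congr rfl fun j _ => ?_
  rw [map_mul, scaleX_geom_xv, map_sub, map_one, scaleX_xv, ← mul_assoc, mul_comm (geom _) (1 - _),
    mul_geom (constantCoeff_C_mul_xv y j), one_mul]

/-- The two monomials that multiply to x^μ have degrees adding up to |μ|, so the exponent of y is m
+ 1 plus the degree of the second monomial. That surplus amounts to scaling the second factor by y,
after which `cauchy_mul_scaleX` applies. -/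
theorem coeff_coeff_peel (q y y' : B) (m : ℕ) (μ : Fin N → ℕ) :
    coeff (tail μ) (PowerSeries.coeff (m + ∑ i, μ i + 1)
      (PowerSeries.mk (fun k => (C y : MvPowerSeries (Fin N) B) ^ k) *
        homogenize (xdeg N) (cauchy N y * cauchy N y') *
        PowerSeries.C ((∏ j, (1 - xv B j) * geom (C q * xv B j)) * weight N q)))
      = y ^ (m + 1) * twoVar q (q * y) y' μ := by
  rw [coeff_coeff_geometric_mul_homogenize _ _ _ _ (by rw [xdeg_tail]; omega), twoVar,
    mul_right_comm, ← cauchy_mul_scaleX, mul_right_comm, coeff_mul, Finset.mul_sum]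
  refine Finset.sum_congr rfl fun p hp => ?_
  rw [Finset.HasAntidiagonal.mem_antidiagonal] at hp
  rw [coeff_scaleX]
  have h : m + ∑ i, μ i + 1 - xdeg N p.1 = m + 1 + xdeg N p.2 := by
    have := congrArg (xdeg N) hp
    rw [map_add, xdeg_tail] at this
    omega
  rw [h, pow_add]
  ring

/-- Peeling off the first part. -/
theorem sub_mul_twoVar_cons (q y₁ y₂ : B) (m : ℕ) (μ : Fin N → ℕ) :
    (y₁ - y₂) * twoVar q y₁ y₂ (Fin.cons m μ : Fin (N + 1) → ℕ)
      = y₁ ^ (m + 1) * twoVar q (q * y₁) y₂ μ - y₂ ^ (m + 1) * twoVar q y₁ (q * y₂) μ := by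
  set c : B → PowerSeries (MvPowerSeries (Fin N) B) := fun y => PowerSeries.mk fun k => C y ^ k
    with hc
  set H := PowerSeries.C ((∏ j, (1 - xv B j) * geom (C q * xv B j)) * weight N q) with hH
  set F := homogenize (xdeg N) (cauchy N y₁ * cauchy N y₂) with hF
  have h1 : ∀ y, (1 - PowerSeries.X * PowerSeries.C (C y)) * c y = 1 := fun y => mk_pow_mul _
  -- Partial fractions: (y₁ - y₂) X / ((1 - y₁X)(1 - y₂X)) = 1/(1 - y₁X) - 1/(1 - y₂X). The extra X
  -- is why the coefficient is taken one degree above m + |μ|.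
  have key : PowerSeries.X * (PowerSeries.C (C (y₁ - y₂)) *
      finSuccEquiv B N (cauchy (N + 1) y₁ * cauchy (N + 1) y₂ * weight (N + 1) q))
      = c y₁ * F * H - c y₂ * F * H := by
    rw [map_mul, map_mul, finSuccEquiv_cauchy, finSuccEquiv_cauchy, finSuccEquiv_weight, hF,
      map_mul (homogenize _), map_sub, map_sub]
    have h2 : PowerSeries.X * (PowerSeries.C (C y₁) - PowerSeries.C (C y₂)) * (c y₁ * c y₂)
        = c y₁ - c y₂ := by
      linear_combination c y₂ * (-h1 y₁) + c y₁ * h1 y₂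
    linear_combination (homogenize (xdeg N) (cauchy N y₁) * homogenize (xdeg N) (cauchy N y₂) * H)
      * h2
  have h3 := congrArg (fun z => coeff (tail μ) (PowerSeries.coeff (m + ∑ i, μ i + 1) z)) key
  rw [PowerSeries.coeff_succ_X_mul, PowerSeries.coeff_C_mul, coeff_C_mul,
    coeff_coeff_finSuccEquiv, map_sub, map_sub] at h3
  rw [← tail_cons] at h3
  rw [twoVar, h3, hc, hH, hF, coeff_coeff_peel, mul_comm (cauchy N y₁), coeff_coeff_peel]
  rw [twoVar, twoVar, twoVar, mul_comm (cauchy N y₁)]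

theorem twoVar_zero (q y₁ y₂ : B) (μ : Fin 0 → ℕ) : twoVar q y₁ y₂ μ = 1 := by
  have : tail μ = 0 := Subsingleton.elim _ _
  simp [twoVar, cauchy, weight, this]

end

end KostkaFoulkes
namespace KostkaFoulkes

noncomputable section

open scoped Polynomial

/-! ### The recursion for lists of parts -/

/-- Polynomials in `y₁`, `y₂` over `ℤ[q]`. -/
abbrev YPoly : Type := MvPolynomial (Fin 2) ℤ[X]

/-- The parameter `q`. -/
def qY : YPoly := MvPolynomial.C Polynomial.X

/-- The variable `y₁`. -/
def y1 : YPoly := MvPolynomial.X 0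

/-- The variable `y₂`. -/
def y2 : YPoly := MvPolynomial.X 1

/-- The substitution `y₁ ↦ q y₁`. -/
def shift1 : YPoly →+* YPoly := (MvPolynomial.aeval ![qY * y1, y2]).toRingHom

/-- The substitution `y₂ ↦ q y₂`. -/
def shift2 : YPoly →+* YPoly := (MvPolynomial.aeval ![y1, qY * y2]).toRingHom

theorem shift1_qY : shift1 qY = qY := MvPolynomial.aeval_C _ _
theorem shift2_qY : shift2 qY = qY := MvPolynomial.aeval_C _ _
theorem shift1_y1 : shift1 y1 = qY * y1 := MvPolynomial.aeval_X _ _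
theorem shift1_y2 : shift1 y2 = y2 := MvPolynomial.aeval_X _ _
theorem shift2_y1 : shift2 y1 = y1 := MvPolynomial.aeval_X _ _
theorem shift2_y2 : shift2 y2 = qY * y2 := MvPolynomial.aeval_X _ _

theorem shift1_shift2 (f : YPoly) : shift1 (shift2 f) = shift2 (shift1 f) := by
  have h : shift1.comp shift2 = shift2.comp shift1 := by
    refine MvPolynomial.ringHom_ext (fun c => ?_) fun i => ?_
    · have h1 : shift1 (MvPolynomial.C c) = MvPolynomial.C c := MvPolynomial.aeval_C _ _
      have h2 : shift2 (MvPolynomial.C c) = MvPolynomial.C c := MvPolynomial.aeval_C _ _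
      simp only [RingHom.comp_apply, h1, h2]
    · fin_cases i
      · change shift1 (shift2 y1) = shift2 (shift1 y1)
        simp only [map_mul, shift1_y1, shift2_y1, shift2_qY]
      · change shift1 (shift2 y2) = shift2 (shift1 y2)
        simp only [map_mul, shift1_y2, shift2_y2, shift1_qY]
  exact congrArg (fun g : YPoly →+* YPoly => g f) h

theorem ne_zero_of_eval (f : YPoly) (v : Fin 2 → ℤ[X]) (h : MvPolynomial.eval v f ≠ 0) :
    f ≠ 0 := by
  rintro rfl
  exact h (map_zero _)

theorem y1_sub_y2_ne_zero : y1 - y2 ≠ 0 :=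
  ne_zero_of_eval _ ![1, 0] (by simp [y1, y2])

theorem qY_mul_y1_sub_y2_ne_zero : qY * y1 - y2 ≠ 0 :=
  ne_zero_of_eval _ ![0, 1] (by simp [y1, y2])

theorem y1_sub_qY_mul_y2_ne_zero : y1 - qY * y2 ≠ 0 :=
  ne_zero_of_eval _ ![1, 0] (by simp [y1, y2])

/-- The modified Hall–Littlewood polynomial in `y₁`, `y₂` attached to a list of parts. -/
def listHL (l : List ℕ) : YPoly := twoVar qY y1 y2 fun i : Fin l.length => l.get i

theorem twoVar_eq_listHL {N : ℕ} (μ : Fin N → ℕ) :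
    twoVar qY y1 y2 μ = listHL (List.ofFn μ) := by
  have h : ∀ {M : ℕ} (ν : Fin M → ℕ) (hNM : M = N), (∀ i, ν i = μ (Fin.cast hNM i)) →
      twoVar qY y1 y2 μ = twoVar qY y1 y2 ν := by
    intro M ν hNM hν
    subst hNM
    exact congrArg _ (funext fun i => (hν i).symm)
  exact h _ List.length_ofFn fun i => List.get_ofFn μ i

theorem listHL_nil : listHL [] = 1 := twoVar_zero _ _ _ _

theorem sub_mul_listHL_cons (m : ℕ) (l : List ℕ) :
    (y1 - y2) * listHL (m :: l)
      = y1 ^ (m + 1) * shift1 (listHL l) - y2 ^ (m + 1) * shift2 (listHL l) := by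
  have h : (fun i : Fin (m :: l).length => (m :: l).get i)
      = (Fin.cons m fun i : Fin l.length => l.get i : Fin (l.length + 1) → ℕ) := by
    funext i
    refine Fin.cases ?_ (fun i => ?_) i <;> rfl
  rw [listHL, h]
  have := sub_mul_twoVar_cons qY y1 y2 m fun i : Fin l.length => l.get i
  rw [listHL, map_twoVar shift1, map_twoVar shift2, shift1_qY, shift1_y1, shift1_y2, shift2_qY,
    shift2_y1, shift2_y2]
  exact this

/-- Prepending a part is linear over the elements fixed by both shifts, so a proportionality between
two suffixes survives any common prefix. -/
theorem listHL_append_of_mul {s t : List ℕ} {c : YPoly} (hc1 : shift1 c = c) (hc2 : shift2 c = c)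
    (h : listHL s = c * listHL t) (l : List ℕ) : listHL (l ++ s) = c * listHL (l ++ t) := by
  induction l with
  | nil => exact h
  | cons m l ih =>
    refine mul_left_cancel₀ y1_sub_y2_ne_zero ?_
    rw [List.cons_append, List.cons_append, mul_left_comm, sub_mul_listHL_cons,
      sub_mul_listHL_cons, ih, map_mul, map_mul, hc1, hc2]
    ring

theorem listHL_append_zero (l : List ℕ) : listHL (l ++ [0]) = listHL l := by
  have h0 : listHL [0] = 1 * listHL [] := by
    refine mul_left_cancel₀ y1_sub_y2_ne_zero ?_
    rw [sub_mul_listHL_cons, listHL_nil]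
    simp
  have := listHL_append_of_mul (map_one shift1) (map_one shift2) h0 l
  rwa [List.append_nil, one_mul] at this

theorem shift1_listHL_cons (m : ℕ) (l : List ℕ) :
    (qY * y1 - y2) * shift1 (listHL (m :: l)) = (qY * y1) ^ (m + 1) * shift1 (shift1 (listHL l))
      - y2 ^ (m + 1) * shift1 (shift2 (listHL l)) := by
  have h := congrArg shift1 (sub_mul_listHL_cons m l)
  simpa only [map_mul, map_sub, map_pow, shift1_y1, shift1_y2] using h

theorem shift2_listHL_cons (m : ℕ) (l : List ℕ) :
    (y1 - qY * y2) * shift2 (listHL (m :: l)) = y1 ^ (m + 1) * shift1 (shift2 (listHL l))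
      - (qY * y2) ^ (m + 1) * shift2 (shift2 (listHL l)) := by
  have h := congrArg shift2 (sub_mul_listHL_cons m l)
  -- The mixed term is put in the same order as in `shift1_listHL_cons`, so that the two can cancel.
  rw [shift1_shift2]
  simpa only [map_mul, map_sub, map_pow, shift2_y1, shift2_y2] using h

/-! ### Relations between lists of parts -/

/-- Straightening two consecutive parts `r, r + 1`. -/
theorem listHL_exchange (l : List ℕ) (r : ℕ) (t : List ℕ) :
    listHL (l ++ r :: (r + 1) :: t) = qY * listHL (l ++ (r + 1) :: r :: t) := by
  refine listHL_append_of_mul shift1_qY shift2_qY ?_ l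
  -- Peeling two parts produces the denominators y₁ - y₂, q y₁ - y₂ and y₁ - q y₂. Once they are
  -- cleared, both sides are combinations of the three double shifts of `listHL t`, and the
  -- coefficients agree.
  refine mul_left_cancel₀ y1_sub_y2_ne_zero (mul_left_cancel₀ qY_mul_y1_sub_y2_ne_zero
    (mul_left_cancel₀ y1_sub_qY_mul_y2_ne_zero ?_))
  have h1 := sub_mul_listHL_cons r ((r + 1) :: t)
  have h2 := sub_mul_listHL_cons (r + 1) (r :: t)
  have a1 := shift1_listHL_cons r t
  have a2 := shift2_listHL_cons r t
  have b1 := shift1_listHL_cons (r + 1) t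
  have b2 := shift2_listHL_cons (r + 1) t
  linear_combination (y1 - qY * y2) * (qY * y1 - y2) * h1
    - qY * (y1 - qY * y2) * (qY * y1 - y2) * h2
    + (y1 - qY * y2) * y1 ^ (r + 1) * b1 - (qY * y1 - y2) * y2 ^ (r + 1) * b2
    - qY * (y1 - qY * y2) * y1 ^ (r + 2) * a1 + qY * (qY * y1 - y2) * y2 ^ (r + 2) * a2

theorem listHL_singleton (b : ℕ) :
    (y1 - y2) * listHL [b] = y1 ^ (b + 1) - y2 ^ (b + 1) := by
  rw [sub_mul_listHL_cons, listHL_nil, map_one, map_one, mul_one, mul_one]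

/-- With no further parts the double shifts are 1, so this is an identity of explicit polynomials
once denominators are cleared. The parts are written as d + (b + 1) and b + 1 to avoid truncated
subtraction. -/
theorem listHL_pair (d b : ℕ) :
    listHL [d + (b + 1), b + 1] = qY * listHL [d + (b + 1) + 1, b]
      + (y1 * y2) ^ (b + 1) * listHL [d] := by
  refine mul_left_cancel₀ y1_sub_y2_ne_zero (mul_left_cancel₀ qY_mul_y1_sub_y2_ne_zero
    (mul_left_cancel₀ y1_sub_qY_mul_y2_ne_zero ?_))
  have h1 := sub_mul_listHL_cons (d + (b + 1)) [b + 1]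
  have h2 := sub_mul_listHL_cons (d + (b + 1) + 1) [b]
  have h3 := listHL_singleton d
  have a1 := shift1_listHL_cons (b + 1) []
  have a2 := shift2_listHL_cons (b + 1) []
  have b1 := shift1_listHL_cons b []
  have b2 := shift2_listHL_cons b []
  simp only [listHL_nil, map_one, mul_one] at a1 a2 b1 b2
  linear_combination (y1 - qY * y2) * (qY * y1 - y2) * h1
    - qY * (y1 - qY * y2) * (qY * y1 - y2) * h2
    - (y1 - qY * y2) * (qY * y1 - y2) * (y1 * y2) ^ (b + 1) * h3
    + (y1 - qY * y2) * y1 ^ (d + b + 2) * a1 - (qY * y1 - y2) * y2 ^ (d + b + 2) * a2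
    - qY * (y1 - qY * y2) * y1 ^ (d + b + 3) * b1 + qY * (qY * y1 - y2) * y2 ^ (d + b + 3) * b2

/-- Both shifts multiply y₁y₂ by q, so each part of `l` contributes a factor q^b to the last term;
the coefficient q of the other term is fixed by both. -/
theorem listHL_append_pair (l : List ℕ) {a b : ℕ} (hb : 0 < b) (hab : b ≤ a) :
    listHL (l ++ [a, b]) = qY * listHL (l ++ [a + 1, b - 1])
      + qY ^ (l.length * b) * ((y1 * y2) ^ b * listHL (l ++ [a - b])) := by
  induction l with
  | nil =>
    obtain ⟨c, rfl⟩ : ∃ c, b = c + 1 := ⟨b - 1, by omega⟩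
    obtain ⟨d, rfl⟩ : ∃ d, a = d + (c + 1) := ⟨a - (c + 1), by omega⟩
    have := listHL_pair d c
    simpa using this
  | cons m l ih =>
    refine mul_left_cancel₀ y1_sub_y2_ne_zero ?_
    have h1 := sub_mul_listHL_cons m (l ++ [a, b])
    have h2 := sub_mul_listHL_cons m (l ++ [a + 1, b - 1])
    have h3 := sub_mul_listHL_cons m (l ++ [a - b])
    rw [ih] at h1
    simp only [map_add, map_mul, map_pow, shift1_y1, shift1_y2, shift2_y1, shift2_y2, shift1_qY,
      shift2_qY] at h1
    simp only [List.cons_append, List.length_cons]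
    rw [add_mul, one_mul, pow_add]
    linear_combination h1 - qY * h2 - qY ^ (l.length * b) * qY ^ b * (y1 * y2) ^ b * h3

/-! ### Extracting the coefficients in `y₁`, `y₂` -/

/-- Only the products x_i y occur, so the degree in y is the degree in x. -/
theorem cauchy_eq_scaleX {B : Type*} [CommRing B] (N : ℕ) (y : B) :
    cauchy N y = scaleX N y (cauchy N 1) := by
  rw [cauchy, cauchy, map_prod]
  refine Finset.prod_congr rfl fun i _ => ?_
  rw [scaleX_geom_xv, one_mul]

theorem coeff_cauchy (N : ℕ) (y : YPoly) (e : Fin N →₀ ℕ) :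
    MvPowerSeries.coeff e (cauchy N y)
      = y ^ xdeg N e * MvPolynomial.C (MvPowerSeries.coeff e (cauchy N (1 : ℤ[X]))) := by
  rw [cauchy_eq_scaleX, coeff_scaleX]
  congr 1
  rw [← MvPowerSeries.coeff_map, map_cauchy, map_one]

/-- The exponent of `y₁ ^ a * y₂ ^ b`. -/
def yExp (a b : ℕ) : Fin 2 →₀ ℕ := Finsupp.single 0 a + Finsupp.single 1 b

theorem yExp_inj {a b c d : ℕ} : yExp a b = yExp c d ↔ a = c ∧ b = d := by
  constructor
  · intro h
    have h0 := DFunLike.congr_fun h 0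
    have h1 := DFunLike.congr_fun h 1
    simp [yExp] at h0 h1
    exact ⟨h0, h1⟩
  · rintro ⟨rfl, rfl⟩
    rfl

theorem coeff_y_pow (a b i j : ℕ) (c : ℤ[X]) :
    MvPolynomial.coeff (yExp a b) (y1 ^ i * y2 ^ j * MvPolynomial.C c)
      = if i = a ∧ j = b then c else 0 := by
  have h : y1 ^ i * y2 ^ j * MvPolynomial.C c = MvPolynomial.monomial (yExp i j) c := by
    rw [y1, y2, MvPolynomial.X_pow_eq_monomial, MvPolynomial.X_pow_eq_monomial,
      MvPolynomial.monomial_mul, mul_comm, MvPolynomial.C_mul_monomial, one_mul, mul_one, yExp]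
  rw [h, MvPolynomial.coeff_monomial]
  simp only [yExp_inj]

/-- Fixing the exponents of y₁ and y₂ selects homogeneous parts of the two Cauchy products; by
`weightPart_cauchy` these are h_a and h_b. -/
theorem coeff_twoVar_eq_weightPart {N : ℕ} (μ : Fin N → ℕ) (a b : ℕ) :
    MvPolynomial.coeff (yExp a b) (twoVar qY y1 y2 μ)
      = MvPowerSeries.coeff (tail μ) (weightPart (xdeg N) a (cauchy N (1 : ℤ[X])) *
          weightPart (xdeg N) b (cauchy N 1) * weight N Polynomial.X) := by
  rw [twoVar, MvPowerSeries.coeff_mul, MvPowerSeries.coeff_mul, MvPolynomial.coeff_sum]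
  refine Finset.sum_congr rfl fun p _ => ?_
  rw [MvPowerSeries.coeff_mul, MvPowerSeries.coeff_mul, Finset.sum_mul, Finset.sum_mul,
    MvPolynomial.coeff_sum]
  refine Finset.sum_congr rfl fun r _ => ?_
  have hw : MvPowerSeries.coeff p.2 (weight N qY)
      = MvPolynomial.C (MvPowerSeries.coeff p.2 (weight N Polynomial.X)) := by
    rw [← MvPowerSeries.coeff_map, map_weight]
    rfl
  rw [coeff_cauchy, coeff_cauchy, hw, coeff_weightPart, coeff_weightPart]
  have h : ∀ c d e : ℤ[X], y1 ^ xdeg N r.1 * MvPolynomial.C c * (y2 ^ xdeg N r.2 * MvPolynomial.C d)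
      * MvPolynomial.C e = y1 ^ xdeg N r.1 * y2 ^ xdeg N r.2 * MvPolynomial.C (c * d * e) := by
    intro c d e
    rw [map_mul, map_mul]
    ring
  rw [h, coeff_y_pow]
  by_cases h1 : xdeg N r.1 = a
  · by_cases h2 : xdeg N r.2 = b
    · simp [h1, h2]
    · simp [h2]
  · simp [h1]

/-- The complete homogeneous symmetric polynomial of degree `a` in `x_0, …, x_{N-1}`. -/
def completeX (N a : ℕ) : MvPolynomial (Fin N) ℤ[X] :=
  ∑ α ∈ Finset.finsuppAntidiag Finset.univ a, MvPolynomial.monomial α 1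

/-- Polynomials in `x` as power series in the coordinates `T`. -/
def toSeries (N : ℕ) : MvPolynomial (Fin N) ℤ[X] →ₐ[ℤ[X]] MvPowerSeries (Fin N) ℤ[X] :=
  MvPolynomial.aeval (xv ℤ[X])

theorem toSeries_X {N : ℕ} (i : Fin N) : toSeries N (MvPolynomial.X i) = xv ℤ[X] i :=
  MvPolynomial.aeval_X _ _

theorem weightPart_cauchy (N a : ℕ) :
    weightPart (xdeg N) a (cauchy N (1 : ℤ[X])) = toSeries N (completeX N a) := by
  have h : ∀ i : Fin N, homogenize (xdeg N) (geom (MvPowerSeries.C (1 : ℤ[X]) * xv ℤ[X] i))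
      = PowerSeries.mk fun k => xv ℤ[X] i ^ k := by
    intro i
    refine eq_of_mul_eq_one ?_ (mk_pow_mul _)
    rw [← homogenize_xv, ← map_one (homogenize (xdeg N)), ← map_sub, ← map_mul, map_one, one_mul,
      mul_geom (constantCoeff_xv i)]
  rw [← coeff_homogenize, cauchy, map_prod, PowerSeries.coeff_prod, completeX, map_sum]
  refine Finset.sum_congr rfl fun α _ => ?_
  rw [toSeries, MvPolynomial.aeval_monomial, map_one (algebraMap _ _), one_mul,
    Finsupp.prod_fintype _ _ (by simp)]
  refine Finset.prod_congr rfl fun i _ => ?_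
  rw [h, PowerSeries.coeff_mk]

/-- The coefficient of `x^μ` in `f ∏_{a < b} (1 - x_b / x_a) / (1 - q x_b / x_a)`. -/
def hlCoeff {N : ℕ} (μ : Fin N → ℕ) : MvPolynomial (Fin N) ℤ[X] →ₗ[ℤ[X]] ℤ[X] :=
  (MvPowerSeries.coeff (tail μ)).comp
    ((LinearMap.mulRight ℤ[X] (weight N Polynomial.X)).comp (toSeries N).toLinearMap)

theorem hlCoeff_apply {N : ℕ} (μ : Fin N → ℕ) (f : MvPolynomial (Fin N) ℤ[X]) :
    hlCoeff μ f = MvPowerSeries.coeff (tail μ) (toSeries N f * weight N Polynomial.X) := rfl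

theorem coeff_twoVar {N : ℕ} (μ : Fin N → ℕ) (a b : ℕ) :
    MvPolynomial.coeff (yExp a b) (twoVar qY y1 y2 μ)
      = hlCoeff μ (completeX N a * completeX N b) := by
  rw [coeff_twoVar_eq_weightPart, weightPart_cauchy, weightPart_cauchy, hlCoeff_apply,
    map_mul (toSeries N)]

end

end KostkaFoulkes
namespace KostkaFoulkes

noncomputable section

open scoped Polynomial

/-! ### Lengths of permutations -/

/-- `q` to the number of inversions of `w`. -/
def invWeight {N : ℕ} (w : Equiv.Perm (Fin N)) : ℤ[X] :=
  ∏ a, ∏ b, if a < b ∧ ¬ w a < w b then Polynomial.X else 1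

/-- The permutation `w` with `w 0 = k` inducing the permutation `w'` on the other indices. -/
def permCons {N : ℕ} (k : Fin (N + 1)) (w' : Equiv.Perm (Fin N)) : Equiv.Perm (Fin (N + 1)) :=
  ((finSuccEquiv' 0).trans (Equiv.optionCongr w')).trans (finSuccEquiv' k).symm

theorem permCons_zero {N : ℕ} (k : Fin (N + 1)) (w' : Equiv.Perm (Fin N)) :
    permCons k w' 0 = k := by
  simp [permCons]

theorem permCons_succ {N : ℕ} (k : Fin (N + 1)) (w' : Equiv.Perm (Fin N)) (j : Fin N) :
    permCons k w' j.succ = k.succAbove (w' j) := by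
  have : finSuccEquiv' (0 : Fin (N + 1)) j.succ = some j := by
    rw [← Fin.succAbove_zero]
    exact finSuccEquiv'_succAbove _ _
  simp [permCons, this]

theorem permCons_bijective (N : ℕ) : Function.Bijective
    fun x : Fin (N + 1) × Equiv.Perm (Fin N) => permCons x.1 x.2 := by
  rw [Fintype.bijective_iff_injective_and_card]
  constructor
  · rintro ⟨k, w⟩ ⟨k', w'⟩ h
    simp only at h
    have h0 : k = k' := by rw [← permCons_zero k w, h, permCons_zero]
    subst h0
    congr 1
    ext j
    have := congrArg (fun e : Equiv.Perm (Fin (N + 1)) => e j.succ) h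
    simp only [permCons_succ] at this
    rw [Fin.succAbove_right_injective this]
  · rw [Fintype.card_prod, Fintype.card_perm, Fintype.card_perm, Fintype.card_fin,
      Fintype.card_fin, Nat.factorial_succ]

theorem prod_succAbove_inv {N : ℕ} (k : Fin (N + 1)) :
    (∏ j : Fin N, if k < k.succAbove j then 1 else Polynomial.X : ℤ[X]) = Polynomial.X ^ (k : ℕ) := by
  have h : ∀ j : Fin N, (if k < k.succAbove j then 1 else Polynomial.X : ℤ[X])
      = Polynomial.X ^ (if (j : ℕ) < k then 1 else 0) := by
    intro j
    by_cases hj : (j : ℕ) < k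
    · rw [Fin.succAbove_of_castSucc_lt _ _ (by rwa [Fin.lt_def]), if_neg, if_pos hj, pow_one]
      rw [Fin.lt_def]
      simp only [Fin.val_castSucc]
      omega
    · rw [Fin.succAbove_of_le_castSucc _ _ (by rw [Fin.le_def]; simp only [Fin.val_castSucc]; omega),
        if_pos, if_neg hj, pow_zero]
      rw [Fin.lt_def]
      simp only [Fin.val_succ]
      omega
  simp_rw [h]
  rw [Finset.prod_pow_eq_pow_sum]
  congr 1
  rw [Fin.sum_univ_eq_sum_range (fun j => if j < (k : ℕ) then 1 else 0) N, ← Finset.card_filter]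
  have : (Finset.range N).filter (fun j => j < (k : ℕ)) = Finset.range k := by
    ext j
    have := k.isLt
    simp only [Finset.mem_filter, Finset.mem_range]
    omega
  rw [this, Finset.card_range]

/-- The first value k exceeds exactly k later values, and skipping k does not change the relative
order of the others. -/
theorem invWeight_permCons {N : ℕ} (k : Fin (N + 1)) (w' : Equiv.Perm (Fin N)) :
    invWeight (permCons k w') = Polynomial.X ^ (k : ℕ) * invWeight w' := by
  rw [invWeight, Fin.prod_univ_succ]
  congr 1
  · rw [Fin.prod_univ_succ, if_neg (by simp), one_mul, ← prod_succAbove_inv k,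
      ← Equiv.prod_comp w' (fun j => if k < k.succAbove j then (1 : ℤ[X]) else Polynomial.X)]
    refine Finset.prod_congr rfl fun j _ => ?_
    rw [permCons_zero, permCons_succ]
    simp only [Fin.succ_pos, true_and]
    split_ifs <;> rfl
  · refine Finset.prod_congr rfl fun i _ => ?_
    rw [Fin.prod_univ_succ, if_neg (by simp), one_mul]
    refine Finset.prod_congr rfl fun j _ => ?_
    simp only [permCons_succ, Fin.succ_lt_succ_iff, (Fin.strictMono_succAbove k).lt_iff_lt]

theorem sum_pow_of_lower {n : ℕ} (P : Fin n → Prop) [DecidablePred P]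
    (hP : ∀ i j, i ≤ j → P j → P i) :
    (∑ k, if P k then Polynomial.X ^ (k : ℕ) else 0 : ℤ[X])
      = ∑ k ∈ Finset.range (Finset.univ.filter P).card, Polynomial.X ^ k := by
  rw [Finset.card_filter]
  induction n with
  | zero => simp
  | succ n ih =>
    by_cases h : P (Fin.last n)
    · have hall : ∀ i, P i := fun i => hP i _ (Fin.le_last i) h
      simp only [hall, if_true, Finset.sum_const, Finset.card_univ, Fintype.card_fin, smul_eq_mul,
        mul_one]
      exact Fin.sum_univ_eq_sum_range (fun k => (Polynomial.X : ℤ[X]) ^ k) (n + 1)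
    · rw [Fin.sum_univ_castSucc, Fin.sum_univ_castSucc, if_neg h, if_neg h, add_zero, add_zero]
      exact ih (fun i => P i.castSucc) fun i j hij => hP _ _ (Fin.castSucc_le_castSucc_iff.2 hij)

/-- If ν k = ν 0, monotonicity makes ν constant on [0, k], so skipping k or skipping 0 gives the
same sequence of values. -/
theorem comp_permCons_eq_iff {N : ℕ} {ν : Fin (N + 1) → ℕ} (hν : Antitone ν) (k : Fin (N + 1))
    (w' : Equiv.Perm (Fin N)) :
    (∀ i, ν (permCons k w' i) = ν i) ↔ ν k = ν 0 ∧ ∀ j, ν (w' j).succ = ν j.succ := by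
  have h : ν k = ν 0 → ∀ j, ν (k.succAbove j) = ν j.succ := by
    intro hk j
    by_cases hj : (j : ℕ) < k
    · rw [Fin.succAbove_of_castSucc_lt _ _ (by rwa [Fin.lt_def])]
      have h1 : j.castSucc ≤ k := by rw [Fin.le_def, Fin.val_castSucc]; omega
      have h2 : j.succ ≤ k := by rw [Fin.le_def, Fin.val_succ]; omega
      have := hν h1
      have := hν h2
      have := hν (Fin.zero_le j.castSucc)
      have := hν (Fin.zero_le j.succ)
      omega
    · rw [Fin.succAbove_of_le_castSucc _ _ (by rw [Fin.le_def]; simp only [Fin.val_castSucc]; omega)]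
  constructor
  · intro hw
    have h0 := hw 0
    rw [permCons_zero] at h0
    refine ⟨h0, fun j => ?_⟩
    rw [← h h0, ← permCons_succ, hw]
  · rintro ⟨h0, hw⟩ i
    refine Fin.cases ?_ (fun j => ?_) i
    · rw [permCons_zero, h0]
    · rw [permCons_succ, h h0, hw]

theorem vPoly_succ (m : ℕ) :
    vPoly (m + 1) = vPoly m * ∑ k ∈ Finset.range (m + 1), Polynomial.X ^ k :=
  Finset.prod_range_succ _ _

/-- The Poincaré polynomial of a stabilizer in the symmetric group. -/
theorem sum_stabilizer_invWeight {N : ℕ} (ν : Fin N → ℕ) (hν : Antitone ν) (M : ℕ)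
    (hM : ∀ i, ν i ≤ M) :
    (∑ w : Equiv.Perm (Fin N), if ∀ i, ν (w i) = ν i then invWeight w else 0)
      = ∏ i ∈ Finset.range (M + 1), vPoly (Finset.univ.filter fun r => ν r = i).card := by
  induction N with
  | zero => simp [invWeight, vPoly]
  | succ N ih =>
    have hν' : Antitone fun j : Fin N => ν j.succ :=
      fun i j hij => hν (Fin.succ_le_succ_iff.2 hij)
    rw [← (Equiv.ofBijective _ (permCons_bijective N)).sum_comp, Fintype.sum_prod_type]
    simp only [Equiv.ofBijective_apply, comp_permCons_eq_iff hν, invWeight_permCons]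
    have hsplit : ∀ (k : Fin (N + 1)) (w : Equiv.Perm (Fin N)),
        (if ν k = ν 0 ∧ ∀ j, ν (w j).succ = ν j.succ then Polynomial.X ^ (k : ℕ) * invWeight w
          else 0)
        = (if ν k = ν 0 then Polynomial.X ^ (k : ℕ) else 0) *
          if ∀ j, ν (w j).succ = ν j.succ then invWeight w else 0 := by
      intro k w
      by_cases h1 : ν k = ν 0 <;> by_cases h2 : ∀ j, ν (w j).succ = ν j.succ <;> simp [h1, h2]
    simp only [hsplit]
    -- The admissible values of w 0 form an initial segment whose length is the multiplicity m of ν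
    -- 0. They contribute 1 + q + ⋯ + q^{m-1}, the factor by which v_m exceeds v_{m-1}.
    rw [← Finset.sum_mul_sum, ih _ hν' fun i => hM _, sum_pow_of_lower (fun k => ν k = ν 0)]
    · have hcard : ∀ i, (Finset.univ.filter fun r => ν r = i).card
          = (if ν 0 = i then 1 else 0) + (Finset.univ.filter fun r : Fin N => ν r.succ = i).card := by
        intro i
        rw [Finset.card_filter, Fin.sum_univ_succ, Finset.card_filter]
      have h0 : ν 0 ∈ Finset.range (M + 1) := Finset.mem_range.2 (Nat.lt_succ_of_le (hM 0))
      rw [← Finset.mul_prod_erase _ _ h0, ← Finset.mul_prod_erase _ _ h0, hcard (ν 0), if_pos rfl,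
        add_comm 1, vPoly_succ]
      have : ∏ x ∈ (Finset.range (M + 1)).erase (ν 0),
          vPoly (Finset.univ.filter fun r => ν r = x).card
          = ∏ x ∈ (Finset.range (M + 1)).erase (ν 0),
            vPoly (Finset.univ.filter fun r : Fin N => ν r.succ = x).card := by
        refine Finset.prod_congr rfl fun x hx => ?_
        rw [hcard, if_neg (Finset.ne_of_mem_erase hx).symm, zero_add]
      rw [this]
      ring
    · intro i j hij hj
      have := hν hij
      have := hν (Fin.zero_le i)
      omega

theorem vPart_eq (N : ℕ) (lam : YoungDiagram) :
    vPart N lam = ∑ w : Equiv.Perm (Fin N),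
      if ∀ i, lam.rowLen (w i) = lam.rowLen i then invWeight w else 0 :=
  (sum_stabilizer_invWeight (fun i : Fin N => lam.rowLen i)
    (fun i j hij => lam.rowLen_anti i j hij) (lam.rowLen 0)
    fun i => lam.rowLen_anti 0 i (Nat.zero_le _)).symm

/-- The value at q = 0 is 1. -/
theorem vPart_ne_zero (N : ℕ) (lam : YoungDiagram) : vPart N lam ≠ 0 := by
  intro h
  have h1 : ∀ m, (vPoly m).eval 0 = 1 := by
    intro m
    rw [vPoly, Polynomial.eval_prod]
    refine Finset.prod_eq_one fun j _ => ?_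
    rw [Polynomial.eval_finsetSum, Finset.sum_range_succ']
    simp
  have h2 := congrArg (Polynomial.eval 0) h
  rw [vPart, Polynomial.eval_prod, Polynomial.eval_zero] at h2
  simp only [h1, Finset.prod_const_one] at h2
  exact one_ne_zero h2

/-! ### Clearing denominators in the Hall–Littlewood polynomials -/

/-- The pairs of indices `a < b`. -/
def posPairs (N : ℕ) : Finset (Fin N × Fin N) := Finset.univ.filter fun p => p.1 < p.2

theorem mem_posPairs {N : ℕ} {p : Fin N × Fin N} : p ∈ posPairs N ↔ p.1 < p.2 := by
  simp [posPairs]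

theorem prod_posPairs {M : Type*} [CommMonoid M] {N : ℕ} (f : Fin N → Fin N → M) :
    ∏ p ∈ posPairs N, f p.1 p.2 = ∏ a, ∏ b, if a < b then f a b else 1 := by
  rw [posPairs, Finset.prod_filter, Fintype.prod_prod_type]

/-- A permutation permutes the unordered pairs of indices and reverses the order precisely at its
inversions. -/
theorem prod_posPairs_perm {M : Type*} [CommMonoid M] {N : ℕ} (w : Equiv.Perm (Fin N))
    (f : Fin N → Fin N → M) :
    ∏ p ∈ posPairs N, f (w p.1) (w p.2)
      = ∏ p ∈ posPairs N, if w.symm p.1 < w.symm p.2 then f p.1 p.2 else f p.2 p.1 := by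
  refine Finset.prod_nbij' (fun p => if w p.1 < w p.2 then (w p.1, w p.2) else (w p.2, w p.1))
    (fun p => if w.symm p.1 < w.symm p.2 then (w.symm p.1, w.symm p.2)
      else (w.symm p.2, w.symm p.1)) ?_ ?_ ?_ ?_ ?_
  · rintro ⟨a, b⟩ h
    rw [mem_posPairs] at h ⊢
    have hne : w a ≠ w b := fun h' => h.ne (w.injective h')
    simp only
    split_ifs with h'
    · exact h'
    · exact lt_of_le_of_ne (not_lt.1 h') hne.symm
  · rintro ⟨a, b⟩ h
    rw [mem_posPairs] at h ⊢
    have hne : w.symm a ≠ w.symm b := fun h' => h.ne (w.symm.injective h')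
    simp only
    split_ifs with h'
    · exact h'
    · exact lt_of_le_of_ne (not_lt.1 h') hne.symm
  · rintro ⟨a, b⟩ h
    rw [mem_posPairs] at h
    simp only at h
    by_cases h' : w a < w b
    · simp [h', h]
    · simp [h', h.not_gt]
  · rintro ⟨a, b⟩ h
    rw [mem_posPairs] at h
    simp only at h
    by_cases h' : w.symm a < w.symm b
    · simp [h', h]
    · simp [h', h.not_gt]
  · rintro ⟨a, b⟩ h
    rw [mem_posPairs] at h
    simp only at h
    by_cases h' : w a < w b
    · simp [h', h]
    · simp [h', h.not_gt]

theorem ratX_sub_ne_zero {N : ℕ} {a b : Fin N} (h : a ≠ b) : (ratX a - ratX b : RatFun N) ≠ 0 := by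
  rw [sub_ne_zero]
  intro h'
  exact h (MvPolynomial.X_injective (IsFractionRing.injective _ _ h'))

open MvPolynomial in
/-- The Hall–Littlewood polynomial, with all denominators cleared. -/
theorem hallLittlewood_cleared {N : ℕ} {lam : YoungDiagram} {p : MvPolynomial (Fin N) ℤ[X]}
    (hp : algebraMap _ (RatFun N) p = hallLittlewoodRat N lam) :
    C (vPart N lam) * p * ∏ r ∈ posPairs N, (X r.1 - X r.2)
      = ∑ w : Equiv.Perm (Fin N), (∏ i, X (w i) ^ lam.rowLen i) *
        ∏ r ∈ posPairs N, if w.symm r.1 < w.symm r.2 then X r.1 - C Polynomial.X * X r.2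
          else C Polynomial.X * X r.1 - X r.2 := by
  apply IsFractionRing.injective (MvPolynomial (Fin N) ℤ[X]) (RatFun N)
  have hv : ratC N (vPart N lam) ≠ 0 := by
    rw [ratC, Ne, map_eq_zero_iff _ (IsFractionRing.injective _ _), map_eq_zero_iff _
      (MvPolynomial.C_injective _ _)]
    exact vPart_ne_zero N lam
  have h1 : algebraMap (MvPolynomial (Fin N) ℤ[X]) (RatFun N) (C (vPart N lam)) *
      algebraMap (MvPolynomial (Fin N) ℤ[X]) (RatFun N) p
      = ∑ w : Equiv.Perm (Fin N), (∏ i : Fin N, ratX (w i) ^ lam.rowLen i) *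
        ∏ p ∈ posPairs N,
        (ratX (w p.1) - ratC N Polynomial.X * ratX (w p.2)) / (ratX (w p.1) - ratX (w p.2)) := by
    rw [hp, hallLittlewoodRat]
    exact mul_div_cancel₀ _ hv
  rw [map_mul, map_mul, h1, map_sum, Finset.sum_mul]
  refine Finset.sum_congr rfl fun w _ => ?_
  rw [map_mul, mul_assoc]
  congr 1
  · rw [map_prod]
    exact Finset.prod_congr rfl fun i _ => (map_pow _ _ _).symm
  · rw [prod_posPairs_perm w fun a b => (ratX a - ratC N Polynomial.X * ratX b) / (ratX a - ratX b),
      map_prod, map_prod, ← Finset.prod_mul_distrib]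
    refine Finset.prod_congr rfl fun r hr => ?_
    rw [mem_posPairs] at hr
    rw [map_sub]
    change _ * (ratX r.1 - ratX r.2) = _
    split_ifs
    · rw [div_mul_cancel₀ _ (ratX_sub_ne_zero hr.ne), map_sub, map_mul]
      rfl
    -- At a reversed pair, (x_b - q x_a)/(x_b - x_a) = (q x_a - x_b)/(x_a - x_b), so all w share the
    -- same Vandermonde denominator.
    · rw [map_sub, map_mul]
      change _ = ratC N Polynomial.X * ratX r.1 - ratX r.2
      have := ratX_sub_ne_zero hr.ne'
      field_simp
      ring

/-! ### Duality -/

theorem xv_eq_mul_tv {B : Type*} [CommRing B] {N : ℕ} {a b : Fin N} (h : a < b) :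
    xv B b = xv B a * tv B a b := by
  rw [xv, xv, tv, ← Finset.prod_mul_distrib]
  refine Finset.prod_congr rfl fun k _ => ?_
  by_cases h1 : k ≤ a
  · simp [h1, h1.trans h.le, h1.not_gt]
  · simp [h1, not_le.1 h1]

theorem xv_eq_monomial {B : Type*} [CommRing B] {N : ℕ} (i : Fin N) :
    xv B i = MvPowerSeries.monomial
      (Finsupp.equivFunOnFinite.symm fun k => if k ≤ i then 1 else 0) 1 := prod_X_eq_monomial _

theorem xv_ne_zero {N : ℕ} (i : Fin N) : xv ℤ[X] i ≠ 0 := by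
  rw [xv_eq_monomial]
  intro h
  have := congrArg (MvPowerSeries.coeff
    (Finsupp.equivFunOnFinite.symm fun k => if k ≤ i then 1 else 0)) h
  rw [MvPowerSeries.coeff_monomial_same, map_zero] at this
  exact one_ne_zero this

theorem monomial_prod {σ ι B : Type*} [CommRing B] (s : Finset ι) (e : ι → σ →₀ ℕ) :
    ∏ i ∈ s, (MvPowerSeries.monomial (e i) (1 : B)) = MvPowerSeries.monomial (∑ i ∈ s, e i) 1 := by
  classical
  induction s using Finset.induction_on with
  | empty => simp
  | insert a s ha ih =>
    rw [Finset.prod_insert ha, Finset.sum_insert ha, ih, MvPowerSeries.monomial_mul_monomial,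
      one_mul]

theorem prod_xv_pow {B : Type*} [CommRing B] {N : ℕ} (α : Fin N → ℕ) :
    ∏ i, xv B i ^ α i = MvPowerSeries.monomial (tail α) 1 := by
  simp only [xv_eq_monomial, MvPowerSeries.monomial_pow, one_pow]
  rw [monomial_prod]
  congr 2
  ext k
  simp [Finsupp.finsetSum_apply, tail_apply]

theorem weight_eq_prod_posPairs {B : Type*} [CommRing B] (N : ℕ) (q : B) :
    weight N q = ∏ r ∈ posPairs N,
      ((1 - tv B r.1 r.2) * geom (MvPowerSeries.C q * tv B r.1 r.2)) :=
  (prod_posPairs fun a b => (1 - tv B a b) * geom (MvPowerSeries.C q * tv B a b)).symm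

theorem toSeries_C {N : ℕ} (c : ℤ[X]) :
    toSeries N (MvPolynomial.C c) = MvPowerSeries.C c := MvPolynomial.aeval_C _ _

/-- The contribution of a permutation to `P_λ ∏_{a < b} (1 - x_b / x_a) / (1 - q x_b / x_a)`. -/
def inversionSeries {N : ℕ} (w : Equiv.Perm (Fin N)) : MvPowerSeries (Fin N) ℤ[X] :=
  ∏ r ∈ posPairs N, if w.symm r.1 < w.symm r.2 then 1
    else (MvPowerSeries.C Polynomial.X - tv ℤ[X] r.1 r.2) *
      geom (MvPowerSeries.C Polynomial.X * tv ℤ[X] r.1 r.2)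

theorem toSeries_prod_X_pow {N : ℕ} (w : Equiv.Perm (Fin N)) (ν : Fin N → ℕ) :
    toSeries N (∏ i, MvPolynomial.X (w i) ^ ν i)
      = MvPowerSeries.monomial (tail fun i => ν (w.symm i)) 1 := by
  rw [← prod_xv_pow, map_prod, ← Equiv.prod_comp w fun i => xv ℤ[X] i ^ ν (w.symm i)]
  refine Finset.prod_congr rfl fun i _ => ?_
  rw [map_pow, toSeries_X, Equiv.symm_apply_apply]

/-- Put t = x_b/x_a. Divided by x_a (1 - q t), a pair in order contributes 1 and an inversion
contributes (q - t)/(1 - q t). -/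
theorem toSeries_prod_posPairs {N : ℕ} (w : Equiv.Perm (Fin N)) :
    toSeries N (∏ r ∈ posPairs N, if w.symm r.1 < w.symm r.2
        then MvPolynomial.X r.1 - MvPolynomial.C Polynomial.X * MvPolynomial.X r.2
        else MvPolynomial.C Polynomial.X * MvPolynomial.X r.1 - MvPolynomial.X r.2) *
      ∏ r ∈ posPairs N, geom (MvPowerSeries.C Polynomial.X * tv ℤ[X] r.1 r.2)
      = (∏ r ∈ posPairs N, xv ℤ[X] r.1) * inversionSeries w := by
  rw [map_prod, inversionSeries, ← Finset.prod_mul_distrib, ← Finset.prod_mul_distrib]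
  refine Finset.prod_congr rfl fun r hr => ?_
  rw [mem_posPairs] at hr
  have hg := mul_geom (constantCoeff_C_mul_tv (Polynomial.X : ℤ[X]) hr)
  split_ifs
  · rw [map_sub, map_mul, toSeries_X, toSeries_X, toSeries_C, xv_eq_mul_tv hr]
    linear_combination (xv ℤ[X] r.1) * hg
  · rw [map_sub, map_mul, toSeries_X, toSeries_X, toSeries_C, xv_eq_mul_tv hr]
    ring

theorem toSeries_prod_sub {N : ℕ} :
    toSeries N (∏ r ∈ posPairs N, (MvPolynomial.X r.1 - MvPolynomial.X r.2))
      = (∏ r ∈ posPairs N, xv ℤ[X] r.1) * ∏ r ∈ posPairs N, (1 - tv ℤ[X] r.1 r.2) := by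
  rw [map_prod, ← Finset.prod_mul_distrib]
  refine Finset.prod_congr rfl fun r hr => ?_
  rw [map_sub, toSeries_X, toSeries_X, xv_eq_mul_tv (mem_posPairs.1 hr)]
  ring

/-- The Vandermonde product is ∏ x_a times the numerator ∏ (1 - x_b/x_a) of the weight, so the
denominators x_a - x_b disappear; the common monomial ∏ x_a is cancelled in a domain. -/
theorem toSeries_hallLittlewood_mul_weight {N : ℕ} {lam : YoungDiagram}
    {p : MvPolynomial (Fin N) ℤ[X]} (hp : algebraMap _ (RatFun N) p = hallLittlewoodRat N lam) :
    MvPowerSeries.C (vPart N lam) * (toSeries N p * weight N Polynomial.X)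
      = ∑ w : Equiv.Perm (Fin N), MvPowerSeries.monomial
          (tail fun i => lam.rowLen (w.symm i)) 1 * inversionSeries w := by
  have h := congrArg (toSeries N) (hallLittlewood_cleared hp)
  rw [map_mul, map_mul, map_sum, toSeries_C, toSeries_prod_sub] at h
  have hx : ∏ r ∈ posPairs N, xv ℤ[X] r.1 ≠ 0 := Finset.prod_ne_zero_iff.2 fun r _ => xv_ne_zero _
  refine mul_left_cancel₀ hx ?_
  rw [weight_eq_prod_posPairs, Finset.prod_mul_distrib]
  set G := ∏ r ∈ posPairs N, geom (MvPowerSeries.C Polynomial.X * tv ℤ[X] r.1 r.2) with hG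
  have h2 := congrArg (fun z => z * G) h
  rw [Finset.sum_mul] at h2
  rw [Finset.mul_sum]
  refine Eq.trans ?_ (h2.trans ?_)
  · ring
  · refine Finset.sum_congr rfl fun w _ => ?_
    rw [map_mul, toSeries_prod_X_pow, mul_assoc, hG, toSeries_prod_posPairs, mul_left_comm]

theorem constantCoeff_geom {σ B : Type*} [CommRing B] {z : MvPowerSeries σ B}
    (hz : MvPowerSeries.constantCoeff z = 0) : MvPowerSeries.constantCoeff (geom z) = 1 := by
  have := congrArg MvPowerSeries.constantCoeff (mul_geom hz)
  simpa [hz] using this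

theorem constantCoeff_inversionSeries {N : ℕ} (w : Equiv.Perm (Fin N)) :
    MvPowerSeries.constantCoeff (inversionSeries w) = invWeight w.symm := by
  rw [inversionSeries, map_prod, invWeight]
  have := prod_posPairs (fun a b => if w.symm a < w.symm b then (1 : ℤ[X]) else Polynomial.X)
  have h2 : ∀ a b : Fin N, (if a < b ∧ ¬ w.symm a < w.symm b then (Polynomial.X : ℤ[X]) else 1)
      = if a < b then (if w.symm a < w.symm b then (1 : ℤ[X]) else Polynomial.X) else 1 := by
    intro a b
    by_cases h : a < b <;> by_cases h' : w.symm a < w.symm b <;> simp [h, h']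
  simp only [h2]
  rw [← this]
  refine Finset.prod_congr rfl fun r hr => ?_
  rw [mem_posPairs] at hr
  split_ifs
  · exact map_one _
  · rw [map_mul, constantCoeff_geom (constantCoeff_C_mul_tv _ hr), map_sub, constantCoeff_tv hr]
    simp

/-! ### Supports and triangularity -/

/-- The series whose monomials have exponents in a submonoid. -/
def SupportedIn {σ B : Type*} [CommRing B] (S : AddSubmonoid (σ →₀ ℕ)) (F : MvPowerSeries σ B) :
    Prop := ∀ e, MvPowerSeries.coeff e F ≠ 0 → e ∈ S

namespace SupportedIn

variable {σ B : Type*} [CommRing B] {S : AddSubmonoid (σ →₀ ℕ)}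

theorem monomial {e : σ →₀ ℕ} (he : e ∈ S) (c : B) :
    SupportedIn S (MvPowerSeries.monomial e c) := by
  classical
  intro e' h
  rw [MvPowerSeries.coeff_monomial] at h
  by_cases h' : e' = e
  · rwa [h']
  · exact absurd (if_neg h') h

theorem mul {F G : MvPowerSeries σ B} (hF : SupportedIn S F) (hG : SupportedIn S G) :
    SupportedIn S (F * G) := by
  classical
  intro e h
  rw [MvPowerSeries.coeff_mul] at h
  obtain ⟨p, hp, hne⟩ := Finset.exists_ne_zero_of_sum_ne_zero h
  rw [Finset.HasAntidiagonal.mem_antidiagonal] at hp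
  rw [← hp]
  exact S.add_mem (hF _ (left_ne_zero_of_mul hne)) (hG _ (right_ne_zero_of_mul hne))

theorem one : SupportedIn S (1 : MvPowerSeries σ B) := monomial S.zero_mem 1

theorem sub {F G : MvPowerSeries σ B} (hF : SupportedIn S F) (hG : SupportedIn S G) :
    SupportedIn S (F - G) := by
  intro e h
  rw [map_sub] at h
  by_cases h' : MvPowerSeries.coeff e F = 0
  · exact hG e fun h'' => h (by rw [h', h'', sub_zero])
  · exact hF e h'

theorem prod {ι : Type*} {s : Finset ι} {F : ι → MvPowerSeries σ B}
    (h : ∀ i ∈ s, SupportedIn S (F i)) : SupportedIn S (∏ i ∈ s, F i) :=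
  Finset.prod_induction F (SupportedIn S) (fun _ _ => mul) one h

theorem geom {e : σ →₀ ℕ} (he : e ∈ S) (he0 : e ≠ 0) (c : B) :
    SupportedIn S (geom (MvPowerSeries.monomial e c)) := by
  classical
  have hz : MvPowerSeries.constantCoeff (MvPowerSeries.monomial e c) = 0 := by
    rw [← MvPowerSeries.coeff_zero_eq_constantCoeff_apply, MvPowerSeries.coeff_monomial,
      if_neg he0.symm]
  -- From 1/(1 - z) = 1 + z/(1 - z), a nonzero exponent of the series is `e` plus an exponent of
  -- smaller degree, which sets up the induction.
  have hg : KostkaFoulkes.geom (MvPowerSeries.monomial e c)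
      = 1 + MvPowerSeries.monomial e c * KostkaFoulkes.geom (MvPowerSeries.monomial e c) := by
    linear_combination mul_geom hz
  have key : ∀ n (e' : σ →₀ ℕ), e'.degree = n →
      MvPowerSeries.coeff e' (KostkaFoulkes.geom (MvPowerSeries.monomial e c)) ≠ 0 → e' ∈ S := by
    intro n
    induction n using Nat.strong_induction_on with
    | _ n ih =>
      intro e' hn h
      rw [hg, map_add, MvPowerSeries.coeff_one, MvPowerSeries.coeff_monomial_mul] at h
      by_cases h0 : e' = 0
      · rw [h0]; exact S.zero_mem
      · rw [if_neg h0, zero_add] at h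
        by_cases hle : e ≤ e'
        · rw [if_pos hle] at h
          have hadd : e' - e + e = e' := tsub_add_cancel_of_le hle
          have hdeg : (e' - e).degree + e.degree = e'.degree := by rw [← map_add, hadd]
          have hpos : e.degree ≠ 0 := fun h => he0 ((Finsupp.degree_eq_zero_iff e).1 h)
          rw [← hadd]
          exact S.add_mem (ih _ (by omega) _ rfl (right_ne_zero_of_mul h)) he
        · rw [if_neg hle] at h
          exact absurd rfl h
  exact fun e' => key _ e' rfl

end SupportedIn

theorem exists_partial_differences {N : ℕ} (c : Fin N → ℤ) :
    ∃ d : Fin N → ℤ, ∀ i, (∑ k, if k ≤ i then d k else 0) = c i := by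
  induction N with
  | zero => exact ⟨c, fun i => i.elim0⟩
  | succ N ih =>
    obtain ⟨d, hd⟩ := ih fun i => c i.succ - c 0
    refine ⟨Fin.cons (c 0) d, fun i => ?_⟩
    rw [Fin.sum_univ_succ]
    refine Fin.cases ?_ (fun i => ?_) i
    · simp
    · simp [hd]

/-- A vector `c` defines a functional on exponents in coordinates `T`, whose value on the exponent
of `x^α` is `∑ c_i α_i`. -/
theorem exists_pairing {N : ℕ} (c : Fin N → ℤ) : ∃ φ : (Fin N →₀ ℕ) →+ ℤ,
    (∀ α : Fin N → ℕ, φ (tail α) = ∑ i, c i * α i) ∧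
    ∀ a b : Fin N, a < b →
      φ (Finsupp.equivFunOnFinite.symm fun k => if a < k ∧ k ≤ b then 1 else 0) = c b - c a := by
  obtain ⟨d, hd⟩ := exists_partial_differences c
  refine ⟨{ toFun := fun e => ∑ k, (e k : ℤ) * d k
            map_zero' := by simp
            map_add' := fun e e' => by simp [add_mul, Finset.sum_add_distrib] }, ?_, ?_⟩
  · intro α
    change ∑ k, ((tail α k : ℕ) : ℤ) * d k = _
    simp only [tail_apply, ← hd, Nat.cast_sum, Finset.sum_mul]
    rw [Finset.sum_comm]
    refine Finset.sum_congr rfl fun i _ => Finset.sum_congr rfl fun k _ => ?_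
    split_ifs
    · ring
    · simp
  · intro a b hab
    change ∑ k, (((if a < k ∧ k ≤ b then 1 else 0 : ℕ)) : ℤ) * d k = _
    rw [← hd, ← hd, ← Finset.sum_sub_distrib]
    refine Finset.sum_congr rfl fun k _ => ?_
    by_cases h1 : k ≤ a
    · simp [h1, h1.trans hab.le, h1.not_gt]
    · simp [h1, not_le.1 h1]

theorem tv_eq_monomial {B : Type*} [CommRing B] {N : ℕ} (a b : Fin N) :
    tv B a b = MvPowerSeries.monomial
      (Finsupp.equivFunOnFinite.symm fun k => if a < k ∧ k ≤ b then 1 else 0) 1 :=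
  prod_X_eq_monomial _

theorem supportedIn_inversionSeries {N : ℕ} (w : Equiv.Perm (Fin N))
    {S : AddSubmonoid (Fin N →₀ ℕ)}
    (hS : ∀ a b : Fin N, a < b → w.symm b < w.symm a →
      Finsupp.equivFunOnFinite.symm (fun k => if a < k ∧ k ≤ b then 1 else 0) ∈ S) :
    SupportedIn S (inversionSeries w) := by
  refine SupportedIn.prod fun r hr => ?_
  rw [mem_posPairs] at hr
  split_ifs with h
  · exact SupportedIn.one
  · have hlt : w.symm r.2 < w.symm r.1 :=
      lt_of_le_of_ne (not_lt.1 h) fun h' => hr.ne' (w.symm.injective h')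
    have hmem := hS _ _ hr hlt
    refine SupportedIn.mul (SupportedIn.sub (SupportedIn.monomial S.zero_mem _) ?_) ?_
    · rw [tv_eq_monomial]
      exact SupportedIn.monomial hmem _
    · rw [tv_eq_monomial, ← MvPowerSeries.monomial_zero_eq_C_apply,
        MvPowerSeries.monomial_mul_monomial, zero_add]
      refine SupportedIn.geom hmem (fun h0 => ?_) _
      have := DFunLike.congr_fun h0 r.2
      simp [hr] at this

/-- Write wν for the rearrangement of ν. The difference μ - wν is a sum of vectors e_b - e_a over
inversions a < b. Each of these pairs nonpositively with μ, which decreases, and nonnegatively with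
wν, which does not decrease from a to b at an inversion. Hence |μ - wν|² = ⟨μ - wν, μ⟩ - ⟨μ - wν,
wν⟩ ≤ 0. -/
theorem eq_of_coeff_inversionSeries_ne_zero {N : ℕ} (w : Equiv.Perm (Fin N)) {μ ν : Fin N → ℕ}
    (hμ : Antitone μ) (hν : Antitone ν) (hle : (tail fun i => ν (w.symm i)) ≤ tail μ)
    (h : MvPowerSeries.coeff (tail μ - tail fun i => ν (w.symm i)) (inversionSeries w) ≠ 0) :
    ∀ i, ν (w.symm i) = μ i := by
  obtain ⟨φ, hφ, hφt⟩ := exists_pairing fun i => (μ i : ℤ)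
  obtain ⟨ψ, hψ, hψt⟩ := exists_pairing fun i => (ν (w.symm i) : ℤ)
  let S : AddSubmonoid (Fin N →₀ ℕ) :=
    { carrier := {e | φ e ≤ 0 ∧ 0 ≤ ψ e}
      zero_mem' := by simp
      add_mem' := by
        rintro e e' ⟨h1, h2⟩ ⟨h3, h4⟩
        simp only [Set.mem_ofPred_eq, map_add]
        constructor <;> linarith }
  have hS : SupportedIn S (inversionSeries w) := by
    refine supportedIn_inversionSeries w fun a b hab hw => ⟨?_, ?_⟩
    · rw [hφt a b hab]
      have := hμ hab.le
      omega
    · rw [hψt a b hab]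
      have := hν hw.le
      omega
  obtain ⟨h1, h2⟩ : φ _ ≤ 0 ∧ 0 ≤ ψ _ := hS _ h
  have hadd := tsub_add_cancel_of_le hle
  have e1 := congrArg φ hadd
  have e2 := congrArg ψ hadd
  rw [map_add, hφ, hφ] at e1
  rw [map_add, hψ, hψ] at e2
  have hsq : ∑ i, ((μ i : ℤ) - ν (w.symm i)) ^ 2 ≤ 0 := by
    have : ∑ i, ((μ i : ℤ) - ν (w.symm i)) ^ 2
        = (∑ i, (μ i : ℤ) * μ i) - (∑ i, (μ i : ℤ) * ν (w.symm i))
          - ((∑ i, (ν (w.symm i) : ℤ) * μ i) - ∑ i, (ν (w.symm i) : ℤ) * ν (w.symm i)) := by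
      rw [← Finset.sum_sub_distrib, ← Finset.sum_sub_distrib, ← Finset.sum_sub_distrib]
      exact Finset.sum_congr rfl fun i _ => by ring
    rw [this]
    linarith
  intro i
  have h0 := (Finset.sum_eq_zero_iff_of_nonneg (fun i _ => sq_nonneg ((μ i : ℤ) - ν (w.symm i)))).1
    (le_antisymm hsq (Finset.sum_nonneg fun i _ => sq_nonneg _)) i (Finset.mem_univ i)
  have := pow_eq_zero_iff (two_ne_zero) |>.1 h0
  omega

theorem eq_of_antitone_perm {N : ℕ} {μ ν : Fin N → ℕ} (hμ : Antitone μ) (hν : Antitone ν)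
    (w : Equiv.Perm (Fin N)) (h : ∀ i, ν (w i) = μ i) : μ = ν := by
  have h1 : Monotone (OrderDual.toDual ∘ ν ∘ w) := by
    have : ν ∘ w = μ := funext h
    rw [this]
    exact hμ.dual_right
  have h2 : Monotone ((OrderDual.toDual ∘ ν) ∘ (1 : Equiv.Perm (Fin N))) := hν.dual_right
  have := Tuple.unique_monotone (f := OrderDual.toDual ∘ ν) (σ := w) (τ := 1) h1 h2
  funext i
  rw [← h i]
  exact congrFun this i

/-- The functionals `hlCoeff` are dual to the Hall–Littlewood polynomials. -/
theorem hlCoeff_hallLittlewood {N : ℕ} {lam mu : YoungDiagram} {p : MvPolynomial (Fin N) ℤ[X]}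
    (hp : algebraMap _ (RatFun N) p = hallLittlewoodRat N lam) :
    hlCoeff (fun i : Fin N => mu.rowLen i) p
      = if ∀ i : Fin N, lam.rowLen i = mu.rowLen i then 1 else 0 := by
  have hl : Antitone fun i : Fin N => lam.rowLen i := fun i j hij => lam.rowLen_anti i j hij
  have hm : Antitone fun i : Fin N => mu.rowLen i := fun i j hij => mu.rowLen_anti i j hij
  refine mul_left_cancel₀ (vPart_ne_zero N lam) ?_
  rw [hlCoeff_apply, ← MvPowerSeries.coeff_C_mul, toSeries_hallLittlewood_mul_weight hp, map_sum]
  simp only [MvPowerSeries.coeff_monomial_mul, one_mul]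
  by_cases h : ∀ i : Fin N, lam.rowLen i = mu.rowLen i
  -- Only permutations stabilizing λ contribute, each through the constant term of its series. These
  -- constant terms count inversions of the inverse permutation, hence the reindexing; their sum is
  -- v_λ.
  · rw [if_pos h, mul_one, vPart_eq, ← Equiv.sum_comp (Equiv.inv (Equiv.Perm (Fin N)))]
    have hmu : (fun i : Fin N => mu.rowLen i) = fun i : Fin N => lam.rowLen i :=
      funext fun i => (h i).symm
    rw [hmu]
    refine Finset.sum_congr rfl fun w _ => ?_
    change (if (tail fun i => lam.rowLen (w i)) ≤ _ then MvPowerSeries.coeff (_ - (tail fun i => lam.rowLen (w i))) (inversionSeries w⁻¹) else 0) = _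
    by_cases hw : ∀ i, lam.rowLen (w i) = lam.rowLen i
    · rw [if_pos hw]
      have : (fun i => lam.rowLen (w i)) = fun i : Fin N => lam.rowLen i := funext hw
      rw [this, if_pos le_rfl, tsub_self, MvPowerSeries.coeff_zero_eq_constantCoeff_apply,
        constantCoeff_inversionSeries]
      rfl
    · rw [if_neg hw]
      split_ifs with hle
      · by_contra hne
        exact hw (eq_of_coeff_inversionSeries_ne_zero w⁻¹ hl hl hle hne)
      · rfl
  · rw [if_neg h, mul_zero]
    refine Finset.sum_eq_zero fun w _ => ?_
    split_ifs with hle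
    · by_contra hne
      have := eq_of_coeff_inversionSeries_ne_zero w hm hl hle hne
      have h2 := eq_of_antitone_perm hm hl w.symm this
      exact h fun i => (congrFun h2 i).symm
    · rfl

end

end KostkaFoulkes
namespace KostkaFoulkes

noncomputable section

open scoped Polynomial

/-! ### Young diagrams and their row lengths -/

theorem rowLen_eq_zero_of_le {κ : YoungDiagram} {i : ℕ} (h : κ.colLen 0 ≤ i) : κ.rowLen i = 0 := by
  by_contra h'
  have h1 : (i, 0) ∈ κ := YoungDiagram.mem_iff_lt_rowLen.2 (Nat.pos_of_ne_zero h')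
  rw [YoungDiagram.mem_iff_lt_colLen] at h1
  omega

theorem colLen_le_of_rowLen {κ : YoungDiagram} {i : ℕ} (h : κ.rowLen i = 0) : κ.colLen 0 ≤ i := by
  by_contra h'
  have h1 : (i, 0) ∈ κ := YoungDiagram.mem_iff_lt_colLen.2 (not_le.1 h')
  rw [YoungDiagram.mem_iff_lt_rowLen] at h1
  omega

theorem youngDiagram_ext {κ κ' : YoungDiagram} (h : ∀ i, κ.rowLen i = κ'.rowLen i) : κ = κ' := by
  ext ⟨i, j⟩
  rw [YoungDiagram.mem_cells, YoungDiagram.mem_cells, YoungDiagram.mem_iff_lt_rowLen,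
    YoungDiagram.mem_iff_lt_rowLen, h]

theorem exists_youngDiagram (β : ℕ → ℕ) (hβ : Antitone β) (N : ℕ) (hN : β N = 0) :
    ∃ κ : YoungDiagram, ∀ i, κ.rowLen i = β i := by
  have hmem : ∀ c : ℕ × ℕ, c ∈ (Finset.range N ×ˢ Finset.range (β 0)).filter (fun c => c.2 < β c.1)
      ↔ c.2 < β c.1 := by
    intro c
    rw [Finset.mem_filter, Finset.mem_product, Finset.mem_range, Finset.mem_range]
    refine ⟨fun h => h.2, fun h => ⟨⟨?_, h.trans_le (hβ (Nat.zero_le _))⟩, h⟩⟩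
    by_contra h'
    have := hβ (not_lt.1 h')
    omega
  refine ⟨⟨(Finset.range N ×ˢ Finset.range (β 0)).filter (fun c => c.2 < β c.1), ?_⟩, fun i => ?_⟩
  · intro c c' hle hc
    rw [Finset.mem_coe, hmem] at hc ⊢
    exact (hle.2.trans_lt hc).trans_le (hβ hle.1)
  · refine eq_of_forall_lt_iff fun j => ?_
    rw [← YoungDiagram.mem_iff_lt_rowLen]
    exact hmem (i, j)

theorem exists_twoRow {a b : ℕ} (h : b ≤ a) : ∃ κ : YoungDiagram, κ.colLen 0 ≤ 2 ∧
    κ.rowLen 0 = a ∧ κ.rowLen 1 = b := by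
  obtain ⟨κ, hκ⟩ := exists_youngDiagram (fun i => if i = 0 then a else if i = 1 then b else 0)
    (by
      intro i j hij
      simp only
      split_ifs <;> omega) 2 (by simp)
  refine ⟨κ, colLen_le_of_rowLen (by rw [hκ]; simp), by rw [hκ]; simp, by rw [hκ]; simp⟩

theorem twoRow_ext {κ κ' : YoungDiagram} (h : κ.colLen 0 ≤ 2) (h' : κ'.colLen 0 ≤ 2)
    (h0 : κ.rowLen 0 = κ'.rowLen 0) (h1 : κ.rowLen 1 = κ'.rowLen 1) : κ = κ' := by
  refine youngDiagram_ext fun i => ?_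
  rcases Nat.lt_or_ge i 2 with hi | hi
  · interval_cases i
    · exact h0
    · exact h1
  · rw [rowLen_eq_zero_of_le (h.trans hi), rowLen_eq_zero_of_le (h'.trans hi)]

theorem card_eq_sum_rowLen (κ : YoungDiagram) {n : ℕ} (hn : κ.colLen 0 ≤ n) :
    κ.card = ∑ i ∈ Finset.range n, κ.rowLen i := by
  have h : κ.cells = (Finset.range n).biUnion fun i => κ.row i := by
    ext c
    rw [Finset.mem_biUnion, YoungDiagram.mem_cells]
    constructor
    · intro hc
      refine ⟨c.1, Finset.mem_range.2 (lt_of_lt_of_le ?_ hn), YoungDiagram.mem_row_iff.2 ⟨hc, rfl⟩⟩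
      exact YoungDiagram.mem_iff_lt_colLen.1 (κ.up_left_mem le_rfl (Nat.zero_le c.2) hc)
    · rintro ⟨i, _, hi⟩
      exact (YoungDiagram.mem_row_iff.1 hi).1
  rw [YoungDiagram.card, h, Finset.card_biUnion]
  · exact Finset.sum_congr rfl fun i _ => (κ.rowLen_eq_card).symm
  · intro i _ j _ hij
    rw [Function.onFun, Finset.disjoint_left]
    intro c hc hc'
    exact hij ((YoungDiagram.mem_row_iff.1 hc).2.symm.trans (YoungDiagram.mem_row_iff.1 hc').2)

theorem card_twoRow {κ : YoungDiagram} (h : κ.colLen 0 ≤ 2) :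
    κ.card = κ.rowLen 0 + κ.rowLen 1 := by
  rw [card_eq_sum_rowLen κ h, Finset.sum_range_succ, Finset.sum_range_one]

/-! ### Schur functions in two variables -/

/-- The exponent of `x_0 ^ a * x_1 ^ b`. -/
def xExp (a b : ℕ) : ℕ →₀ ℕ := Finsupp.single 0 a + Finsupp.single 1 b

theorem xExp_zero (a b : ℕ) : xExp a b 0 = a := by simp [xExp]
theorem xExp_one (a b : ℕ) : xExp a b 1 = b := by simp [xExp]
theorem xExp_of_two_le (a b : ℕ) {k : ℕ} (hk : 2 ≤ k) : xExp a b k = 0 := by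
  rw [xExp, Finsupp.add_apply, Finsupp.single_apply, Finsupp.single_apply, if_neg (by omega),
    if_neg (by omega), add_zero]

theorem finset_eq_range_card (S : Finset ℕ) (hS : ∀ i j, i ≤ j → j ∈ S → i ∈ S) :
    S = Finset.range S.card := by
  refine Finset.eq_of_subset_of_card_le (fun x hx => ?_) (by simp)
  have : Finset.range (x + 1) ⊆ S := fun y hy =>
    hS y x (Nat.lt_succ_iff.1 (Finset.mem_range.1 hy)) hx
  have := Finset.card_le_card this
  rw [Finset.card_range] at this
  exact Finset.mem_range.2 this

/-! ### Semistandard tableaux with two letters -/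

section TwoLetters

variable {ν : YoungDiagram} {T : SemistandardYoungTableau ν} {a b : ℕ}

theorem entry_le_one (hT : ∀ k, (ν.cells.filter fun c => T c.1 c.2 = k).card = xExp a b k)
    {i j : ℕ} (h : (i, j) ∈ ν) : T i j ≤ 1 := by
  by_contra h'
  have h1 := hT (T i j)
  rw [xExp_of_two_le _ _ (by omega), Finset.card_eq_zero] at h1
  have : (i, j) ∈ ν.cells.filter fun c => T c.1 c.2 = T i j :=
    Finset.mem_filter.2 ⟨(YoungDiagram.mem_cells _).2 h, rfl⟩
  rw [h1] at this
  exact absurd this (Finset.notMem_empty _)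

theorem row_le_entry (T : SemistandardYoungTableau ν) {i j : ℕ} (h : (i, j) ∈ ν) : i ≤ T i j := by
  induction i with
  | zero => exact Nat.zero_le _
  | succ i ih =>
    have h1 : T i j < T (i + 1) j := T.col_strict (Nat.lt_succ_self i) h
    change i + 1 ≤ T (i + 1) j
    have h2 := ih (ν.up_left_mem (Nat.le_succ i) le_rfl h)
    omega

theorem colLen_le_two_of_content
    (hT : ∀ k, (ν.cells.filter fun c => T c.1 c.2 = k).card = xExp a b k) : ν.colLen 0 ≤ 2 := by
  by_contra h
  have h1 : (2, 0) ∈ ν := YoungDiagram.mem_iff_lt_colLen.2 (not_le.1 h)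
  have := entry_le_one hT h1
  have := row_le_entry T h1
  omega

theorem card_of_content
    (hT : ∀ k, (ν.cells.filter fun c => T c.1 c.2 = k).card = xExp a b k) : ν.card = a + b := by
  have h0 := hT 0
  have h1 := hT 1
  rw [xExp_zero] at h0
  rw [xExp_one] at h1
  rw [YoungDiagram.card, ← Finset.card_filter_add_card_filter_not (fun c => T c.1 c.2 = 0), h0, ← h1]
  congr 2
  refine Finset.filter_congr fun c hc => ?_
  have := entry_le_one hT ((YoungDiagram.mem_cells _).1 hc)
  omega

/-- Strict columns force the zeros into row 0, and weak rows make them an initial segment there. -/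
theorem zeros_of_content
    (hT : ∀ k, (ν.cells.filter fun c => T c.1 c.2 = k).card = xExp a b k) {j : ℕ} :
    (0, j) ∈ ν ∧ T 0 j = 0 ↔ j < a := by
  set S := (Finset.range (ν.rowLen 0)).filter fun j => T 0 j = 0 with hS
  have hmem : ∀ j, j ∈ S ↔ (0, j) ∈ ν ∧ T 0 j = 0 := by
    intro j
    rw [hS, Finset.mem_filter, Finset.mem_range, YoungDiagram.mem_iff_lt_rowLen]
  have hcard : S.card = a := by
    have h0 := hT 0
    rw [xExp_zero] at h0
    rw [← h0]
    refine Finset.card_bij (fun j _ => (0, j)) ?_ ?_ ?_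
    · intro j hj
      rw [hmem] at hj
      exact Finset.mem_filter.2 ⟨(YoungDiagram.mem_cells _).2 hj.1, hj.2⟩
    · intro j _ j' _ h
      exact (Prod.ext_iff.1 h).2
    · rintro ⟨i, j⟩ h
      rw [Finset.mem_filter, YoungDiagram.mem_cells] at h
      have := row_le_entry T h.1
      have hi : i = 0 := by
        have := h.2
        simp only at this
        omega
      subst hi
      exact ⟨j, (hmem j).2 h, rfl⟩
  rw [← hmem, finset_eq_range_card S, hcard, Finset.mem_range]
  intro i j hij hj
  rw [hmem] at hj ⊢
  refine ⟨ν.up_left_mem le_rfl hij hj.1, ?_⟩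
  have := T.row_weak_of_le hij hj.1
  omega

theorem rowLen_one_le_of_content
    (hT : ∀ k, (ν.cells.filter fun c => T c.1 c.2 = k).card = xExp a b k) : ν.rowLen 1 ≤ b := by
  have h1 := hT 1
  rw [xExp_one] at h1
  rw [← h1, YoungDiagram.rowLen_eq_card]
  refine Finset.card_le_card fun c hc => ?_
  rw [YoungDiagram.mem_row_iff] at hc
  refine Finset.mem_filter.2 ⟨(YoungDiagram.mem_cells _).2 hc.1, ?_⟩
  have h2 := entry_le_one hT hc.1
  have h3 := row_le_entry T hc.1
  omega

/-- The content determines the tableau; this is the uniqueness behind `coeff_schur`. -/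
theorem entry_of_content
    (hT : ∀ k, (ν.cells.filter fun c => T c.1 c.2 = k).card = xExp a b k) (i j : ℕ) :
    T i j = if (i, j) ∈ ν then (if i = 0 ∧ j < a then 0 else 1) else 0 := by
  by_cases h : (i, j) ∈ ν
  · rw [if_pos h]
    have h1 := entry_le_one hT h
    have h2 := row_le_entry T h
    by_cases hi : i = 0
    · subst hi
      have := zeros_of_content hT (j := j)
      by_cases hj : j < a
      · rw [if_pos ⟨rfl, hj⟩, (this.2 hj).2]
      · rw [if_neg fun h => hj h.2]
        have : T 0 j ≠ 0 := fun h0 => hj (this.1 ⟨h, h0⟩)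
        omega
    · rw [if_neg fun h => hi h.1]
      omega
  · rw [if_neg h, T.zeros h]

end TwoLetters

open Classical in
/-- The semistandard tableau with two rows and entries in `{0, 1}`, of which `a` are `0`. -/
def twoLetterTableau (ν : YoungDiagram) (hν : ν.colLen 0 ≤ 2) (a : ℕ) (ha : ν.rowLen 1 ≤ a) :
    SemistandardYoungTableau ν where
  entry i j := if (i, j) ∈ ν then (if i = 0 ∧ j < a then 0 else 1) else 0
  row_weak' := by
    intro i j₁ j₂ hj h
    have h' := ν.up_left_mem le_rfl hj.le h
    rw [if_pos h, if_pos h']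
    split_ifs <;> omega
  col_strict' := by
    intro i₁ i₂ j hi h
    have h' := ν.up_left_mem hi.le le_rfl h
    have h2 : i₂ < ν.colLen 0 :=
      YoungDiagram.mem_iff_lt_colLen.1 (ν.up_left_mem le_rfl (Nat.zero_le j) h)
    have hi1 : i₁ = 0 := by omega
    have hi2 : i₂ = 1 := by omega
    subst hi1 hi2
    rw [YoungDiagram.mem_iff_lt_rowLen] at h
    rw [if_pos h', if_pos ⟨rfl, by omega⟩, if_pos (YoungDiagram.mem_iff_lt_rowLen.2 h),
      if_neg (by omega)]
    exact one_pos
  zeros' := fun h => if_neg h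

theorem twoLetterTableau_content {ν : YoungDiagram} (hν : ν.colLen 0 ≤ 2) {a b : ℕ}
    (ha : ν.rowLen 1 ≤ a) (hb : ν.rowLen 1 ≤ b) (hab : ν.rowLen 0 + ν.rowLen 1 = a + b) (k : ℕ) :
    (ν.cells.filter fun c => twoLetterTableau ν hν a ha c.1 c.2 = k).card = xExp a b k := by
  have hentry : ∀ c ∈ ν.cells, twoLetterTableau ν hν a ha c.1 c.2
      = if c.1 = 0 ∧ c.2 < a then 0 else 1 := fun c hc => if_pos ((YoungDiagram.mem_cells _).1 hc)
  have h0 : (ν.cells.filter fun c => twoLetterTableau ν hν a ha c.1 c.2 = 0).card = a := by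
    have : ν.cells.filter (fun c => twoLetterTableau ν hν a ha c.1 c.2 = 0)
        = (Finset.range a).map (Function.Embedding.sectR 0 ℕ) := by
      ext ⟨i, j⟩
      rw [Finset.mem_filter, Finset.mem_map]
      constructor
      · rintro ⟨h, h'⟩
        rw [hentry _ h] at h'
        by_cases hc : i = 0 ∧ j < a
        · exact ⟨j, Finset.mem_range.2 hc.2, by rw [hc.1]; rfl⟩
        · simp only [if_neg hc] at h'
          omega
      · rintro ⟨j', hj', h⟩
        rw [Finset.mem_range] at hj'
        obtain ⟨rfl, rfl⟩ : 0 = i ∧ j' = j := Prod.ext_iff.1 h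
        have hm : (0, j') ∈ ν.cells :=
          (YoungDiagram.mem_cells _).2 (YoungDiagram.mem_iff_lt_rowLen.2 (by omega))
        exact ⟨hm, by rw [hentry _ hm, if_pos ⟨rfl, hj'⟩]⟩
    rw [this, Finset.card_map, Finset.card_range]
  rcases Nat.lt_or_ge k 2 with hk | hk
  · interval_cases k
    · rw [h0, xExp_zero]
    · have hsum := Finset.card_filter_add_card_filter_not
        (s := ν.cells) (fun c => twoLetterTableau ν hν a ha c.1 c.2 = 0)
      have h1 : ν.cells.filter (fun c => ¬ twoLetterTableau ν hν a ha c.1 c.2 = 0)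
          = ν.cells.filter (fun c => twoLetterTableau ν hν a ha c.1 c.2 = 1) := by
        refine Finset.filter_congr fun c hc => ?_
        rw [hentry c hc]
        split_ifs <;> simp
      have hc : ν.cells.card = a + b := (card_twoRow hν).trans hab
      rw [h0, h1, hc] at hsum
      rw [xExp_one]
      omega
  · rw [xExp_of_two_le _ _ hk, Finset.card_eq_zero, Finset.filter_eq_empty_iff]
    intro c hc
    rw [hentry c hc]
    split_ifs <;> omega

open Classical in
/-- The coefficients of a Schur function in two variables. -/
theorem coeff_schur {R : Type*} [CommRing R] (ν : YoungDiagram) {a b : ℕ} (hba : b ≤ a) :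
    MvPowerSeries.coeff (xExp a b) (schur R ν)
      = if ν.colLen 0 ≤ 2 ∧ ν.rowLen 1 ≤ b ∧ ν.rowLen 0 + ν.rowLen 1 = a + b then 1 else 0 := by
  change ((Set.ncard {T : SemistandardYoungTableau ν | ∀ k : ℕ,
    (ν.cells.filter fun c => T c.1 c.2 = k).card = xExp a b k} : ℕ) : R) = _
  split_ifs with h
  · obtain ⟨h1, h2, h3⟩ := h
    have : {T : SemistandardYoungTableau ν | ∀ k : ℕ,
        (ν.cells.filter fun c => T c.1 c.2 = k).card = xExp a b k}
        = {twoLetterTableau ν h1 a (h2.trans hba)} := by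
      ext T
      rw [Set.mem_singleton_iff]
      constructor
      · intro hT
        ext i j
        rw [entry_of_content hT]
        rfl
      · rintro rfl
        exact twoLetterTableau_content h1 _ h2 h3
    rw [this, Set.ncard_singleton, Nat.cast_one]
  · have : {T : SemistandardYoungTableau ν | ∀ k : ℕ,
        (ν.cells.filter fun c => T c.1 c.2 = k).card = xExp a b k} = ∅ := by
      rw [Set.eq_empty_iff_forall_notMem]
      intro T hT
      have h1 := colLen_le_two_of_content hT
      exact h ⟨h1, rowLen_one_le_of_content hT, (card_twoRow h1).symm.trans (card_of_content hT)⟩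
    rw [this, Set.ncard_empty, Nat.cast_zero]

/-- The coefficient of `s_{(a, b)}` in a symmetric polynomial in two variables whose coefficients
are `f`. -/
def schurCoeff (f : ℕ → ℕ → ℤ[X]) (a b : ℕ) : ℤ[X] :=
  f a b - if b = 0 then 0 else f (a + 1) (b - 1)

open Classical in
-- A coefficient of `schur` detects whether the second row of ν is at most b. Subtracting the same
-- condition for b - 1, with the size unchanged, leaves second row equal to b.
theorem schurCoeff_schur {lam : YoungDiagram} (hlam : lam.colLen 0 ≤ 2) (ν : YoungDiagram) :
    schurCoeff (fun a b => MvPowerSeries.coeff (xExp a b) (schur ℤ[X] ν))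
      (lam.rowLen 0) (lam.rowLen 1) = if ν = lam then 1 else 0 := by
  have hle : lam.rowLen 1 ≤ lam.rowLen 0 := lam.rowLen_anti 0 1 zero_le_one
  rw [schurCoeff, coeff_schur ν hle]
  have hiff : ν = lam ↔ ν.colLen 0 ≤ 2 ∧ ν.rowLen 0 = lam.rowLen 0 ∧ ν.rowLen 1 = lam.rowLen 1 := by
    constructor
    · rintro rfl
      exact ⟨hlam, rfl, rfl⟩
    · rintro ⟨h, h0, h1⟩
      exact twoRow_ext h hlam h0 h1
  rw [if_congr hiff rfl rfl]
  by_cases h : ν.colLen 0 ≤ 2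
  · by_cases hb : lam.rowLen 1 = 0
    · rw [if_pos hb, sub_zero]
      refine if_congr ?_ rfl rfl
      simp only [h, true_and]
      omega
    · rw [if_neg hb, coeff_schur ν (by omega)]
      simp only [h, true_and]
      split_ifs <;> first | omega | simp
  · rw [if_neg (by tauto), if_neg (c := _ ∧ _) (by tauto)]
    split_ifs
    · simp
    · rw [coeff_schur ν (by omega), if_neg (by tauto), sub_zero]

theorem schurCoeff_finset_sum {ι : Type*} (s : Finset ι) (c : ι → ℤ[X]) (f : ι → ℕ → ℕ → ℤ[X])
    (a b : ℕ) :
    schurCoeff (fun a b => ∑ i ∈ s, c i * f i a b) a b = ∑ i ∈ s, c i * schurCoeff (f i) a b := by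
  simp only [schurCoeff, mul_sub, Finset.sum_sub_distrib, mul_ite, mul_zero]
  split_ifs <;> simp

/-- The Kostka–Foulkes polynomials with two rows, from the coefficients of `Q'_μ`. -/
theorem eq_schurCoeff_of_isKostkaFoulkes {K : YoungDiagram → YoungDiagram →₀ ℤ[X]}
    (hK : IsKostkaFoulkes K) {lam : YoungDiagram} (hlam : lam.colLen 0 ≤ 2) (mu : YoungDiagram) :
    K mu lam = schurCoeff (fun a b => MvPowerSeries.coeff (xExp a b)
      (modifiedHL mu : MvPowerSeries ℕ ℤ[X])) (lam.rowLen 0) (lam.rowLen 1) := by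
  classical
  have h : (fun a b => MvPowerSeries.coeff (xExp a b) (modifiedHL mu : MvPowerSeries ℕ ℤ[X]))
      = fun a b => ∑ ν ∈ (K mu).support,
        K mu ν * MvPowerSeries.coeff (xExp a b) (schur ℤ[X] ν) := by
    funext a b
    rw [hK mu, Finsupp.sum, map_sum]
    exact Finset.sum_congr rfl fun ν _ => by rw [map_smul, smul_eq_mul]
  rw [h, schurCoeff_finset_sum]
  simp only [schurCoeff_schur hlam, mul_ite, mul_one, mul_zero]
  rw [Finset.sum_ite_eq']
  split_ifs with h'
  · rfl
  · exact Finsupp.notMem_support_iff.1 h'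

end

end KostkaFoulkes
namespace KostkaFoulkes

noncomputable section

open scoped Polynomial

/-! ### Symmetric functions as combinations of monomial symmetric functions -/

theorem expVec_apply (κ : YoungDiagram) (i : ℕ) : expVec κ i = κ.rowLen i := rfl

theorem degree_expVec (κ : YoungDiagram) : (expVec κ).degree = κ.card := by
  rw [card_eq_sum_rowLen κ le_rfl, Finsupp.degree_apply]
  refine Finset.sum_subset (fun i hi => ?_) fun i _ hi => ?_
  · by_contra h
    rw [Finset.mem_range, not_lt] at h
    rw [Finsupp.mem_support_iff, expVec_apply, rowLen_eq_zero_of_le h] at hi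
    exact hi rfl
  · exact Finsupp.notMem_support_iff.1 hi

theorem exists_rearrangement (α : ℕ →₀ ℕ) :
    ∃ (κ : YoungDiagram) (e : Equiv.Perm ℕ), (expVec κ).mapDomain e = α := by
  obtain ⟨N, hN⟩ : ∃ N, ∀ i, N ≤ i → α i = 0 := by
    obtain ⟨N, hN⟩ := α.support.bddAbove
    refine ⟨N + 1, fun i hi => ?_⟩
    by_contra h
    have := hN (Finset.mem_coe.2 (Finsupp.mem_support_iff.2 h))
    omega
  -- The order dual makes `Tuple.sort` sort decreasingly; the permutation is extended by the
  -- identity beyond the support.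
  let f : Fin N → ℕᵒᵈ := fun i => OrderDual.toDual (α i)
  let e : Equiv.Perm ℕ := (Tuple.sort f).viaEmbedding Fin.valEmbedding
  have he : ∀ i (hi : i < N), e i = Tuple.sort f ⟨i, hi⟩ := fun i hi =>
    Equiv.Perm.viaEmbedding_apply (Tuple.sort f) Fin.valEmbedding ⟨i, hi⟩
  have he' : ∀ i, N ≤ i → e i = i := fun i hi =>
    Equiv.Perm.viaEmbedding_apply_of_notMem _ _ _ (by
      rintro ⟨j, rfl⟩
      exact absurd j.isLt (not_lt.2 hi))
  have hanti : Antitone fun i => α (e i) := by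
    intro i j hij
    simp only
    rcases Nat.lt_or_ge j N with hj | hj
    · rw [he i (by omega), he j hj]
      exact Tuple.monotone_sort f (a := ⟨i, by omega⟩) (b := ⟨j, hj⟩) hij
    · rw [he' j hj, hN j hj]
      exact Nat.zero_le _
  obtain ⟨κ, hκ⟩ := exists_youngDiagram _ hanti N (by rw [he' N le_rfl, hN N le_rfl])
  refine ⟨κ, e, ?_⟩
  ext k
  obtain ⟨i, rfl⟩ := e.surjective k
  rw [Finsupp.mapDomain_apply e.injective, expVec_apply, hκ]

/-- The length of column j counts the rows longer than j, which is insensitive to permuting rows. -/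
theorem eq_of_rearrangement {κ κ' : YoungDiagram} {e : Equiv.Perm ℕ}
    (h : (expVec κ).mapDomain e = expVec κ') : κ = κ' := by
  have hrow : ∀ i, κ'.rowLen (e i) = κ.rowLen i := by
    intro i
    rw [← expVec_apply κ', ← h, Finsupp.mapDomain_apply e.injective, expVec_apply]
  have hcol : ∀ (κ : YoungDiagram) j, κ.colLen j = Set.ncard {i | j < κ.rowLen i} := by
    intro κ j
    have : {i | j < κ.rowLen i} = (Finset.range (κ.colLen j) : Set ℕ) := by
      ext i
      rw [Finset.mem_coe, Finset.mem_range, ← YoungDiagram.mem_iff_lt_colLen,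
        YoungDiagram.mem_iff_lt_rowLen]
      rfl
    rw [this, Set.ncard_coe_finset, Finset.card_range]
  have himg : ∀ j, {i | j < κ'.rowLen i} = e '' {i | j < κ.rowLen i} := by
    intro j
    ext i
    obtain ⟨i, rfl⟩ := e.surjective i
    rw [e.injective.mem_set_image]
    change j < κ'.rowLen (e i) ↔ j < κ.rowLen i
    rw [hrow]
  ext ⟨i, j⟩
  rw [YoungDiagram.mem_cells, YoungDiagram.mem_cells, YoungDiagram.mem_iff_lt_colLen,
    YoungDiagram.mem_iff_lt_colLen, hcol κ, hcol κ', himg,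
    Set.ncard_image_of_injective _ e.injective]

variable {R : Type*} [CommRing R]

theorem coeff_mapDomain_symFun (f : symFun R) (e : Equiv.Perm ℕ) (α : ℕ →₀ ℕ) :
    MvPowerSeries.coeff (α.mapDomain e) (f : MvPowerSeries ℕ R)
      = MvPowerSeries.coeff α (f : MvPowerSeries ℕ R) := by
  have h := MvPowerSeries.coeff_embDomain_rename (R := R) e.toEmbedding (f : MvPowerSeries ℕ R) α
  rw [Finsupp.embDomain_eq_mapDomain] at h
  have h2 : MvPowerSeries.rename e.toEmbedding (f : MvPowerSeries ℕ R) = f := f.2.2 e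
  rw [h2] at h
  exact h

open Classical in
theorem coeff_monomialSym (κ : YoungDiagram) (α : ℕ →₀ ℕ) :
    MvPowerSeries.coeff α (monomialSym R κ : MvPowerSeries ℕ R)
      = if ∃ e : Equiv.Perm ℕ, (expVec κ).mapDomain e = α then 1 else 0 := rfl

theorem symFun_eq_sum (f : symFun R) (S : Finset YoungDiagram)
    (hS : ∀ κ, MvPowerSeries.coeff (expVec κ) (f : MvPowerSeries ℕ R) ≠ 0 → κ ∈ S) :
    f = ∑ κ ∈ S, MvPowerSeries.coeff (expVec κ) (f : MvPowerSeries ℕ R) • monomialSym R κ := by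
  classical
  refine Subtype.ext ?_
  ext α
  obtain ⟨κ, e, rfl⟩ := exists_rearrangement α
  rw [AddSubmonoidClass.coe_finsetSum, map_sum, coeff_mapDomain_symFun]
  have hc : ∀ κ' : YoungDiagram, MvPowerSeries.coeff ((expVec κ).mapDomain e)
      ((MvPowerSeries.coeff (expVec κ') (f : MvPowerSeries ℕ R) • monomialSym R κ' : symFun R) :
        MvPowerSeries ℕ R)
      = if κ' = κ then MvPowerSeries.coeff (expVec κ) (f : MvPowerSeries ℕ R) else 0 := by
    intro κ'
    rw [Subalgebra.coe_smul, map_smul, smul_eq_mul, coeff_mapDomain_symFun, coeff_monomialSym]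
    by_cases h : κ' = κ
    · subst h
      rw [if_pos ⟨1, Finsupp.mapDomain_id⟩, if_pos rfl, mul_one]
    · rw [if_neg h, if_neg, mul_zero]
      rintro ⟨e', he'⟩
      exact h (eq_of_rearrangement he')
  simp only [hc]
  rw [Finset.sum_ite_eq']
  split_ifs with h
  · rfl
  · by_contra h'
    exact h (hS κ h')

theorem rowLen_le_card (κ : YoungDiagram) (i : ℕ) : κ.rowLen i ≤ κ.card := by
  rw [YoungDiagram.rowLen_eq_card]
  exact Finset.card_le_card (Finset.filter_subset _ _)

theorem colLen_le_card (κ : YoungDiagram) (j : ℕ) : κ.colLen j ≤ κ.card := by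
  rw [YoungDiagram.colLen_eq_card]
  exact Finset.card_le_card (Finset.filter_subset _ _)

theorem finite_card_le (D : ℕ) : {κ : YoungDiagram | κ.card ≤ D}.Finite := by
  refine Set.Finite.of_finite_image (f := YoungDiagram.cells) (Set.Finite.subset
    (Finset.range D ×ˢ Finset.range D).powerset.finite_toSet ?_) ?_
  · rintro _ ⟨κ, hκ, rfl⟩
    rw [Finset.mem_coe, Finset.mem_powerset]
    intro c hc
    rw [YoungDiagram.mem_cells] at hc
    rw [Finset.mem_product, Finset.mem_range, Finset.mem_range]
    exact ⟨(YoungDiagram.mem_iff_lt_colLen.1 hc).trans_le ((colLen_le_card κ _).trans hκ),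
      (YoungDiagram.mem_iff_lt_rowLen.1 hc).trans_le ((rowLen_le_card κ _).trans hκ)⟩
  · intro κ _ κ' _ h
    exact YoungDiagram.ext h

/-- The partitions of `d`. -/
def partitionsOf (d : ℕ) : Finset YoungDiagram :=
  (finite_card_le d).toFinset.filter fun κ => κ.card = d

theorem mem_partitionsOf {d : ℕ} {κ : YoungDiagram} : κ ∈ partitionsOf d ↔ κ.card = d := by
  rw [partitionsOf, Finset.mem_filter, Set.Finite.mem_toFinset]
  exact ⟨fun h => h.2, fun h => ⟨h.le, h⟩⟩

/-- Bounded degree makes f a finite combination of monomial symmetric functions, and h_λ picks out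
the coefficient of m_λ. -/
theorem hallInner_completeHProd {B : LinearMap.BilinForm R (symFun R)} (hB : IsHallInner B)
    (lam : YoungDiagram) (f : symFun R) :
    B (completeHProd R lam) f = MvPowerSeries.coeff (expVec lam) (f : MvPowerSeries ℕ R) := by
  classical
  obtain ⟨D, hD⟩ := f.2.1
  have hS : ∀ κ, MvPowerSeries.coeff (expVec κ) (f : MvPowerSeries ℕ R) ≠ 0 →
      κ ∈ (finite_card_le D).toFinset := by
    intro κ hκ
    rw [Set.Finite.mem_toFinset]
    have := hD _ hκ
    rwa [degree_expVec] at this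
  conv_lhs => rw [symFun_eq_sum f _ hS]
  rw [map_sum]
  simp only [map_smul, hB lam, smul_eq_mul, mul_ite, mul_one, mul_zero]
  rw [Finset.sum_ite_eq]
  split_ifs with h
  · rfl
  · by_contra h'
    exact h (hS lam (Ne.symm h'))

/-! ### Homogeneity -/

/-- Multiplication by g shifts homogeneous components by k and is injective, so a stray component of
p would survive in the product. -/
theorem isHomogeneous_of_mul {σ K : Type*} [CommRing K] [IsDomain K] {p g : MvPolynomial σ K}
    {m k : ℕ} (hg : g.IsHomogeneous k) (hg0 : g ≠ 0) (h : (p * g).IsHomogeneous (m + k)) :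
    p.IsHomogeneous m := by
  have hcomp : ∀ i, MvPolynomial.homogeneousComponent (i + k) (p * g)
      = MvPolynomial.homogeneousComponent i p * g := by
    intro i
    conv_lhs => rw [← MvPolynomial.sum_homogeneousComponent p, Finset.sum_mul, map_sum]
    have : ∀ j, MvPolynomial.homogeneousComponent (i + k)
        (MvPolynomial.homogeneousComponent j p * g)
        = if j = i then MvPolynomial.homogeneousComponent i p * g else 0 := by
      intro j
      rw [MvPolynomial.homogeneousComponent_of_mem
        ((MvPolynomial.homogeneousComponent_isHomogeneous j p).mul hg)]
      by_cases hj : j = i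
      · subst hj; simp
      · rw [if_neg (by omega), if_neg hj]
    simp only [this]
    rw [Finset.sum_ite_eq']
    split_ifs with hi
    · rfl
    · rw [MvPolynomial.homogeneousComponent_eq_zero, zero_mul]
      rw [Finset.mem_range, not_lt] at hi
      omega
  intro α hα
  by_contra hne
  have h1 := hcomp α.degree
  rw [MvPolynomial.homogeneousComponent_of_mem h, if_neg (by
    intro h'
    apply hne
    have : Finsupp.weight 1 α = α.degree := by
      rw [Finsupp.degree_eq_weight_one]
      rfl
    omega)] at h1
  have h2 := (mul_eq_zero.1 h1.symm).resolve_right hg0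
  have h3 := congrArg (MvPolynomial.coeff α) h2
  rw [MvPolynomial.coeff_homogeneousComponent, if_pos rfl, MvPolynomial.coeff_zero] at h3
  exact hα h3

theorem hallLittlewood_isHomogeneous {N : ℕ} {lam : YoungDiagram} (hN : lam.colLen 0 ≤ N)
    {p : MvPolynomial (Fin N) ℤ[X]} (hp : algebraMap _ (RatFun N) p = hallLittlewoodRat N lam) :
    p.IsHomogeneous lam.card := by
  have h := hallLittlewood_cleared hp
  have hg : (MvPolynomial.C (vPart N lam) * ∏ r ∈ posPairs N,
      (MvPolynomial.X r.1 - MvPolynomial.X r.2) : MvPolynomial (Fin N) ℤ[X]).IsHomogeneous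
        (∑ _r ∈ posPairs N, 1) :=
    (MvPolynomial.IsHomogeneous.prod _ _ _ fun r _ =>
      (MvPolynomial.isHomogeneous_X _ _).sub (MvPolynomial.isHomogeneous_X _ _)).C_mul _
  refine isHomogeneous_of_mul hg ?_ ?_
  · refine mul_ne_zero ?_ (Finset.prod_ne_zero_iff.2 fun r hr => ?_)
    · rw [Ne, map_eq_zero_iff _ (MvPolynomial.C_injective _ _)]
      exact vPart_ne_zero N lam
    · rw [sub_ne_zero]
      exact fun h' => (mem_posPairs.1 hr).ne (MvPolynomial.X_injective h')
  · rw [mul_left_comm, ← mul_assoc, h]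
    refine MvPolynomial.IsHomogeneous.sum _ _ _ fun w _ => MvPolynomial.IsHomogeneous.mul ?_ ?_
    · rw [card_eq_sum_rowLen lam hN, ← Fin.sum_univ_eq_sum_range (fun i => lam.rowLen i)]
      refine MvPolynomial.IsHomogeneous.prod _ _ _ fun i _ => ?_
      exact MvPolynomial.isHomogeneous_X_pow _ _
    · refine MvPolynomial.IsHomogeneous.prod _ _ _ fun r _ => ?_
      split_ifs
      · exact (MvPolynomial.isHomogeneous_X _ _).sub (MvPolynomial.isHomogeneous_C_mul_X _ _)
      · exact (MvPolynomial.isHomogeneous_C_mul_X _ _).sub (MvPolynomial.isHomogeneous_X _ _)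

theorem exists_mapDomain_val (α : ℕ →₀ ℕ) : ∃ N₀, ∀ N, N₀ ≤ N →
    ∃ β : Fin N →₀ ℕ, β.mapDomain Fin.val = α := by
  obtain ⟨M, hM⟩ := α.support.bddAbove
  refine ⟨M + 1, fun N hN => ⟨α.comapDomain Fin.val Fin.val_injective.injOn,
    Finsupp.mapDomain_comapDomain _ Fin.val_injective _ fun i hi => ?_⟩⟩
  have := hM hi
  exact ⟨⟨i, by omega⟩, rfl⟩

theorem degree_of_coeff_hallLittlewood {lam : YoungDiagram} {f : symFun ℤ[X]}
    (hf : IsHallLittlewoodP lam f) {α : ℕ →₀ ℕ}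
    (hα : MvPowerSeries.coeff α (f : MvPowerSeries ℕ ℤ[X]) ≠ 0) : α.degree = lam.card := by
  obtain ⟨N₀, hN₀⟩ := exists_mapDomain_val α
  obtain ⟨β, rfl⟩ := hN₀ (max N₀ (lam.colLen 0)) (le_max_left _ _)
  obtain ⟨p, hp, hpf⟩ := hf _ (le_max_right N₀ (lam.colLen 0))
  rw [hpf] at hα
  rw [Finsupp.degree_mapDomain]
  by_contra hne
  exact hα ((hallLittlewood_isHomogeneous (le_max_right _ _) hp).coeff_eq_zero hne)

/-! ### Expanding `h_a h_b` in Hall–Littlewood functions -/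

theorem coeff_completeH (r : ℕ) (α : ℕ →₀ ℕ) :
    MvPowerSeries.coeff α (completeH R r : MvPowerSeries ℕ R) = if α.degree = r then 1 else 0 := rfl

theorem completeH_zero : completeH R 0 = 1 := by
  classical
  refine Subtype.ext ?_
  ext α
  rw [coeff_completeH]
  change _ = MvPowerSeries.coeff α (1 : MvPowerSeries ℕ R)
  rw [MvPowerSeries.coeff_one]
  exact if_congr (Finsupp.degree_eq_zero_iff α) rfl rfl

theorem completeHProd_twoRow {κ : YoungDiagram} (h : κ.colLen 0 ≤ 2) :
    completeHProd R κ = completeH R (κ.rowLen 0) * completeH R (κ.rowLen 1) := by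
  rw [completeHProd, ← Finset.prod_range_one (fun i => completeH R (κ.rowLen i)),
    ← Finset.prod_range_succ]
  refine Finset.prod_subset (Finset.range_mono h) fun i _ hi => ?_
  rw [Finset.mem_range, not_lt] at hi
  rw [rowLen_eq_zero_of_le hi, completeH_zero]

theorem expVec_twoRow {κ : YoungDiagram} (h : κ.colLen 0 ≤ 2) :
    expVec κ = xExp (κ.rowLen 0) (κ.rowLen 1) := by
  ext i
  rw [expVec_apply]
  rcases Nat.lt_or_ge i 2 with hi | hi
  · interval_cases i
    · rw [xExp_zero]
    · rw [xExp_one]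
  · rw [xExp_of_two_le _ _ hi, rowLen_eq_zero_of_le (h.trans hi)]

/-- Setting all but the first `N` variables to zero. -/
def truncateVars (N : ℕ) : MvPowerSeries ℕ ℤ[X] →ₐ[ℤ[X]] MvPowerSeries (Fin N) ℤ[X] :=
  MvPowerSeries.killCompl Fin.valEmbedding

theorem coeff_truncateVars (N : ℕ) (f : MvPowerSeries ℕ ℤ[X]) (α : Fin N →₀ ℕ) :
    MvPowerSeries.coeff α (truncateVars N f) = MvPowerSeries.coeff (α.mapDomain Fin.val) f := by
  rw [truncateVars, MvPowerSeries.coeff_killCompl, Finsupp.embDomain_eq_mapDomain]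
  rfl

theorem coeff_completeX (N a : ℕ) (α : Fin N →₀ ℕ) :
    MvPolynomial.coeff α (completeX N a) = if α.degree = a then 1 else 0 := by
  classical
  rw [completeX, MvPolynomial.coeff_sum]
  simp only [MvPolynomial.coeff_monomial]
  rw [Finset.sum_ite_eq']
  refine if_congr ?_ rfl rfl
  rw [Finset.mem_finsuppAntidiag, Finsupp.degree_eq_sum]
  exact ⟨fun h => h.1, fun h => ⟨h, Finset.subset_univ _⟩⟩

theorem truncateVars_completeH (N a : ℕ) :
    truncateVars N (completeH ℤ[X] a : MvPowerSeries ℕ ℤ[X]) = (completeX N a : MvPolynomial _ _) := by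
  ext α : 1
  rw [coeff_truncateVars, MvPolynomial.coeff_coe, coeff_completeX, coeff_completeH,
    Finsupp.degree_mapDomain]

theorem coeff_completeH_mul (N a b : ℕ) (α : Fin N →₀ ℕ) :
    MvPowerSeries.coeff (α.mapDomain Fin.val)
      ((completeH ℤ[X] a * completeH ℤ[X] b : symFun ℤ[X]) : MvPowerSeries ℕ ℤ[X])
      = MvPolynomial.coeff α (completeX N a * completeX N b) := by
  rw [← coeff_truncateVars, ← MvPolynomial.coeff_coe, MvPolynomial.coe_mul,
    ← truncateVars_completeH, ← truncateVars_completeH, ← map_mul (truncateVars N)]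
  rfl

variable {B : LinearMap.BilinForm ℤ[X] (symFun ℤ[X])} {P Q : YoungDiagram → symFun ℤ[X]}

open Classical in
/-- Symmetric functions with a dual family are combinations of Hall–Littlewood functions. -/
theorem exists_hallLittlewood_expansion (hP : ∀ ν, IsHallLittlewoodP ν (P ν))
    (hQ : ∀ ν μ, B (P ν) (Q μ) = if ν = μ then 1 else 0) (d : ℕ) (f : symFun ℤ[X])
    (hf : ∀ α, MvPowerSeries.coeff α (f : MvPowerSeries ℕ ℤ[X]) ≠ 0 → α.degree = d) :
    ∃ c : partitionsOf d → ℤ[X], f = ∑ ν, c ν • P ν := by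
  let M : Matrix (partitionsOf d) (partitionsOf d) ℤ[X] :=
    fun ν κ => MvPowerSeries.coeff (expVec κ) (P ν : MvPowerSeries ℕ ℤ[X])
  let L : Matrix (partitionsOf d) (partitionsOf d) ℤ[X] := fun κ μ => B (monomialSym ℤ[X] κ) (Q μ)
  have hexp : ∀ g : symFun ℤ[X],
      (∀ α, MvPowerSeries.coeff α (g : MvPowerSeries ℕ ℤ[X]) ≠ 0 → α.degree = d) →
      g = ∑ κ : partitionsOf d, MvPowerSeries.coeff (expVec κ) (g : MvPowerSeries ℕ ℤ[X]) •
        monomialSym ℤ[X] κ := by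
    intro g hg
    have h1 := symFun_eq_sum g (partitionsOf d) fun κ hκ => by
      rw [mem_partitionsOf, ← degree_expVec, hg _ hκ]
    rw [← Finset.sum_coe_sort (partitionsOf d)] at h1
    exact h1
  have hPM : ∀ ν : partitionsOf d, P ν = ∑ κ : partitionsOf d, M ν κ • monomialSym ℤ[X] κ :=
    fun ν => hexp _ fun α hα =>
      (degree_of_coeff_hallLittlewood (hP ν) hα).trans (mem_partitionsOf.1 ν.2)
  have hML : M * L = 1 := by
    ext1 ν μ
    rw [Matrix.mul_apply, Matrix.one_apply]
    have h1 := hQ ν μ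
    rw [hPM ν, map_sum, LinearMap.sum_apply] at h1
    simp only [map_smul, LinearMap.smul_apply, smul_eq_mul] at h1
    rw [h1]
    exact if_congr Subtype.ext_iff.symm rfl rfl
  -- A one-sided inverse of a square matrix over a commutative ring is two-sided. Thus the existence
  -- of a dual family alone makes the monomial functions of degree d combinations of the `P ν`.
  have hLM : L * M = 1 := mul_eq_one_comm.1 hML
  have hm : ∀ κ : partitionsOf d, monomialSym ℤ[X] κ = ∑ ν : partitionsOf d, L κ ν • P ν := by
    intro κ
    have h1 : ∑ ν : partitionsOf d, L κ ν • P ν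
        = ∑ κ' : partitionsOf d, (L * M) κ κ' • monomialSym ℤ[X] κ' := by
      simp only [Matrix.mul_apply, Finset.sum_smul]
      rw [Finset.sum_comm]
      refine Finset.sum_congr rfl fun ν _ => ?_
      rw [hPM ν, Finset.smul_sum]
      exact Finset.sum_congr rfl fun κ' _ => by rw [smul_smul]
    rw [h1, hLM]
    simp [Matrix.one_apply]
  refine ⟨fun ν => ∑ κ : partitionsOf d,
    MvPowerSeries.coeff (expVec κ) (f : MvPowerSeries ℕ ℤ[X]) * L κ ν, ?_⟩
  conv_lhs => rw [hexp f hf]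
  simp only [Finset.sum_smul]
  rw [Finset.sum_comm]
  refine Finset.sum_congr rfl fun κ _ => ?_
  conv_lhs => rw [hm κ]
  rw [Finset.smul_sum]
  exact Finset.sum_congr rfl fun ν _ => by rw [smul_smul]

open Classical in
/-- The coefficients of `Q'_μ` in two variables, in terms of `twoVar`. -/
theorem coeff_dual_eq_twoVar (hB : IsHallInner B) (hP : ∀ ν, IsHallLittlewoodP ν (P ν))
    (hQ : ∀ ν μ, B (P ν) (Q μ) = if ν = μ then 1 else 0) {a b : ℕ} (hba : b ≤ a)
    (mu : YoungDiagram) {N : ℕ} (hN : a + b ≤ N) (hmu : mu.colLen 0 ≤ N) :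
    MvPowerSeries.coeff (xExp a b) (Q mu : MvPowerSeries ℕ ℤ[X])
      = MvPolynomial.coeff (yExp a b) (twoVar qY y1 y2 fun i : Fin N => mu.rowLen i) := by
  obtain ⟨κ, hκ, rfl, rfl⟩ := exists_twoRow hba
  set a := κ.rowLen 0
  set b := κ.rowLen 1
  obtain ⟨c, hc⟩ := exists_hallLittlewood_expansion hP hQ (a + b)
    (completeH ℤ[X] a * completeH ℤ[X] b) (by
      intro α hα
      change MvPowerSeries.coeff α ((completeH ℤ[X] a : MvPowerSeries ℕ ℤ[X]) *
        (completeH ℤ[X] b : MvPowerSeries ℕ ℤ[X])) ≠ 0 at hα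
      rw [MvPowerSeries.coeff_mul] at hα
      obtain ⟨p, hp, hne⟩ := Finset.exists_ne_zero_of_sum_ne_zero hα
      rw [Finset.HasAntidiagonal.mem_antidiagonal] at hp
      rw [coeff_completeH, coeff_completeH] at hne
      have h1 : p.1.degree = a := by
        by_contra h
        exact hne (by rw [if_neg h, zero_mul])
      have h2 : p.2.degree = b := by
        by_contra h
        exact hne (by rw [if_neg h, mul_zero])
      rw [← hp, map_add, h1, h2])
  -- This is where N ≥ a + b is needed: every ν that can occur fits into N variables.
  have hcol : ∀ ν : partitionsOf (a + b), (ν : YoungDiagram).colLen 0 ≤ N := fun ν =>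
    (colLen_le_card _ _).trans ((mem_partitionsOf.1 ν.2).le.trans hN)
  choose p hp hpP using fun ν : partitionsOf (a + b) => hP ν N (hcol ν)
  have hpoly : completeX N a * completeX N b = ∑ ν, c ν • p ν := by
    ext1 α
    rw [← coeff_completeH_mul, hc, AddSubmonoidClass.coe_finsetSum, map_sum,
      MvPolynomial.coeff_sum]
    refine Finset.sum_congr rfl fun ν _ => ?_
    rw [Subalgebra.coe_smul, map_smul, hpP, MvPolynomial.coeff_smul]
  -- Both sides extract the coefficient of `P mu` from h_a h_b: one by pairing with `Q mu`, the
  -- other by applying `hlCoeff` in N variables.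
  rw [← expVec_twoRow hκ, ← hallInner_completeHProd hB, completeHProd_twoRow hκ, hc, coeff_twoVar,
    hpoly, map_sum, map_sum, LinearMap.sum_apply]
  refine Finset.sum_congr rfl fun ν _ => ?_
  rw [map_smul, map_smul, LinearMap.smul_apply, hQ, hlCoeff_hallLittlewood (hp ν)]
  congr 1
  refine if_congr ⟨?_, ?_⟩ rfl rfl
  · rintro h i
    rw [h]
  · intro h
    refine youngDiagram_ext fun i => ?_
    rcases Nat.lt_or_ge i N with hi | hi
    · exact h ⟨i, hi⟩
    · rw [rowLen_eq_zero_of_le ((hcol ν).trans hi), rowLen_eq_zero_of_le (hmu.trans hi)]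

/-! ### The Kostka–Foulkes polynomials with two rows -/

/-- The parts of a partition, as a list. -/
def parts (mu : YoungDiagram) (N : ℕ) : List ℕ := (List.range N).map mu.rowLen

theorem listHL_parts (mu : YoungDiagram) {N : ℕ} (h : mu.colLen 0 ≤ N) :
    listHL (parts mu N) = listHL (parts mu (mu.colLen 0)) := by
  induction N, h using Nat.le_induction with
  | base => rfl
  | succ N hN ih =>
    rw [← ih, parts, List.range_succ, List.map_append, List.map_singleton,
      rowLen_eq_zero_of_le hN, listHL_append_zero, parts]

/-- The value of the Kostka–Foulkes polynomials with at most two rows. -/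
def twoRowKostka (a b : ℕ) (f : YPoly) : ℤ[X] :=
  schurCoeff (fun a b => MvPolynomial.coeff (yExp a b) f) a b

/-- The Kostka–Foulkes polynomials with two rows are computed by the polynomials `listHL`. The first
alternative covers the conventions for choices from an empty set. -/
theorem kostkaFoulkes_twoRow :
    (∀ lam mu : YoungDiagram, lam.colLen 0 ≤ 2 → kostkaFoulkes lam mu = 0) ∨
    ∀ lam mu : YoungDiagram, lam.colLen 0 ≤ 2 → kostkaFoulkes lam mu
      = twoRowKostka (lam.rowLen 0) (lam.rowLen 1) (listHL (parts mu (mu.colLen 0))) := by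
  classical
  by_cases hK : ∃ K : YoungDiagram → YoungDiagram →₀ ℤ[X], IsKostkaFoulkes K
  swap
  · exact Or.inl fun lam mu _ => dif_neg hK
  have hk : ∀ lam mu : YoungDiagram, lam.colLen 0 ≤ 2 → kostkaFoulkes lam mu
      = schurCoeff (fun a b => MvPowerSeries.coeff (xExp a b)
        (modifiedHL mu : MvPowerSeries ℕ ℤ[X])) (lam.rowLen 0) (lam.rowLen 1) := by
    intro lam mu hlam
    rw [kostkaFoulkes, dif_pos hK]
    exact eq_schurCoeff_of_isKostkaFoulkes hK.choose_spec hlam mu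
  by_cases hQ : ∃ Q : YoungDiagram → symFun ℤ[X], IsDualToP Q
  swap
  · left
    intro lam mu hlam
    have h0 : modifiedHL = 0 := dif_neg hQ
    rw [hk lam mu hlam, h0]
    simp [schurCoeff]
  right
  have hQ' : IsDualToP modifiedHL := by
    rw [modifiedHL, dif_pos hQ]
    exact hQ.choose_spec
  -- With the default value 0 for the form, duality would give 0 = 1 at the empty partition. The
  -- same argument applies to the Hall–Littlewood functions below.
  have hB : IsHallInner (hallInner ℤ[X]) := by
    by_cases hB : ∃ B : LinearMap.BilinForm ℤ[X] (symFun ℤ[X]), IsHallInner B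
    · rw [hallInner, dif_pos hB]
      exact hB.choose_spec
    · have h0 : hallInner ℤ[X] = 0 := dif_neg hB
      have := hQ' ⊥ ⊥
      rw [h0, if_pos rfl] at this
      exact absurd this zero_ne_one
  have hP : ∀ ν, IsHallLittlewoodP ν (hallLittlewoodP ν) := by
    by_cases hP : ∃ P : YoungDiagram → symFun ℤ[X], ∀ lam, IsHallLittlewoodP lam (P lam)
    · rw [hallLittlewoodP, dif_pos hP]
      exact hP.choose_spec
    · have h0 : hallLittlewoodP = 0 := dif_neg hP
      have := hQ' ⊥ ⊥
      rw [h0, if_pos rfl, Pi.zero_apply, map_zero] at this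
      exact absurd this zero_ne_one
  have hcoeff : ∀ (mu : YoungDiagram) (a b : ℕ), b ≤ a →
      MvPowerSeries.coeff (xExp a b) (modifiedHL mu : MvPowerSeries ℕ ℤ[X])
        = MvPolynomial.coeff (yExp a b) (listHL (parts mu (mu.colLen 0))) := by
    intro mu a b hba
    rw [coeff_dual_eq_twoVar hB hP hQ' hba mu (le_max_left (a + b) (mu.colLen 0))
      (le_max_right _ _), twoVar_eq_listHL, ← listHL_parts mu (le_max_right (a + b) _), parts,
      List.ofFn_eq_map, ← List.map_coe_finRange_eq_range, List.map_map]
    rfl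
  intro lam mu hlam
  have hle : lam.rowLen 1 ≤ lam.rowLen 0 := lam.rowLen_anti 0 1 zero_le_one
  rw [hk lam mu hlam, twoRowKostka, schurCoeff, schurCoeff, hcoeff mu _ _ hle]
  split_ifs
  · rfl
  · rw [hcoeff mu _ _ (by omega)]

end

end KostkaFoulkes
namespace KostkaFoulkes

noncomputable section

open scoped Polynomial LaurentPolynomial

/-! ### The statistic `n` and straightening -/

/-- `∑ (i - 1) l_i` for a list of parts. -/
def listN : List ℕ → ℕ
  | [] => 0
  | _ :: l => listN l + l.sum

theorem listN_append_singleton (l : List ℕ) (x : ℕ) :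
    listN (l ++ [x]) = listN l + l.length * x := by
  induction l with
  | nil => simp [listN]
  | cons m l ih =>
    rw [List.cons_append, listN, ih, listN, List.sum_append, List.sum_singleton, List.length_cons]
    ring

theorem parts_succ (mu : YoungDiagram) (N : ℕ) :
    parts mu (N + 1) = parts mu N ++ [mu.rowLen N] := by
  rw [parts, List.range_succ, List.map_append, List.map_singleton, parts]

theorem length_parts (mu : YoungDiagram) (N : ℕ) : (parts mu N).length = N := by
  rw [parts, List.length_map, List.length_range]

theorem nStat_eq_listN (mu : YoungDiagram) {N : ℕ} (h : mu.colLen 0 ≤ N) :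
    nStat mu = listN (parts mu N) := by
  have h1 : ∀ N, listN (parts mu N) = ∑ i ∈ Finset.range N, i * mu.rowLen i := by
    intro N
    induction N with
    | zero => rfl
    | succ N ih => rw [parts_succ, listN_append_singleton, ih, length_parts, Finset.sum_range_succ]
  rw [h1, nStat]
  refine Finset.sum_subset (Finset.range_mono h) fun i _ hi => ?_
  rw [Finset.mem_range, not_lt] at hi
  rw [rowLen_eq_zero_of_le hi, mul_zero]

/-- The list `l'` is obtained from `l` by straightening. -/
def Straightens (l l' : List ℕ) : Prop :=
  l.sum = l'.sum ∧ ∃ k, listHL l = qY ^ k * listHL l' ∧ listN l = listN l' + k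

theorem Straightens.refl (l : List ℕ) : Straightens l l := ⟨rfl, 0, by simp, rfl⟩

theorem Straightens.trans {l l' l'' : List ℕ} (h : Straightens l l') (h' : Straightens l' l'') :
    Straightens l l'' := by
  obtain ⟨hs, k, hk, hn⟩ := h
  obtain ⟨hs', k', hk', hn'⟩ := h'
  refine ⟨hs.trans hs', k + k', ?_, by omega⟩
  rw [hk, hk', pow_add, mul_assoc]

/-- Prepending a part raises `listN` by the sum of the tail, which is why `Straightens` records the
equality of sums. -/
theorem Straightens.cons {l l' : List ℕ} (h : Straightens l l') (m : ℕ) :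
    Straightens (m :: l) (m :: l') := by
  obtain ⟨hs, k, hk, hn⟩ := h
  refine ⟨by rw [List.sum_cons, List.sum_cons, hs], k, ?_, by rw [listN, listN]; omega⟩
  exact listHL_append_of_mul (by rw [map_pow, shift1_qY]) (by rw [map_pow, shift2_qY]) hk [m]

/-- Moving the larger part forward lowers the statistic by one, matching the single factor q. -/
theorem Straightens.exchange (r : ℕ) (t : List ℕ) :
    Straightens (r :: (r + 1) :: t) ((r + 1) :: r :: t) := by
  refine ⟨by simp only [List.sum_cons]; ring, 1, ?_, by simp only [listN, List.sum_cons]; ring⟩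
  rw [pow_one]
  exact listHL_exchange [] r t

theorem insertionSort_eq_of_perm {l l' : List ℕ} (h : l.Perm l') (hs : l'.Pairwise (· ≥ ·)) :
    l.insertionSort (· ≥ ·) = l' :=
  ((List.perm_insertionSort _ l).trans h).eq_of_pairwise' (List.pairwise_insertionSort _ l) hs

/-- Raising the last part a of a sorted list to a + 1 creates disorder only against earlier parts
equal to a. The part a + 1 moves past these one exchange at a time, and c ≤ a stays at the end. -/
theorem straightens_insertionSort {a c : ℕ} (hc : c ≤ a) (l : List ℕ)
    (hl : (l ++ [a]).Pairwise (· ≥ ·)) :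
    Straightens (l ++ [a + 1, c]) ((l ++ [a + 1, c]).insertionSort (· ≥ ·)) := by
  induction l with
  | nil =>
    rw [List.Pairwise.insertionSort_eq]
    · exact Straightens.refl _
    · simp; omega
  | cons x l ih =>
    rw [List.cons_append, List.pairwise_cons] at hl
    obtain ⟨hx, hl⟩ := hl
    have hxa : a ≤ x := hx a (by simp)
    refine ((ih hl).cons x).trans ?_
    by_cases hax : a + 1 ≤ x
    · rw [List.cons_append, List.insertionSort_cons_of_forall_rel]
      · exact Straightens.refl _
      · intro y hy
        rw [List.mem_append] at hy
        rcases hy with hy | hy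
        · exact hx y (List.mem_append_left _ hy)
        · simp only [List.mem_cons, List.not_mem_nil, or_false] at hy
          omega
    · have hxeq : x = a := by omega
      subst hxeq
      have hsorted : (l ++ [c]).Pairwise (· ≥ ·) := by
        rw [List.pairwise_append] at hl ⊢
        refine ⟨hl.1, List.pairwise_singleton _ _, fun y hy z hz => ?_⟩
        have := hl.2.2 y hy x (by simp)
        rw [List.mem_singleton] at hz
        omega
      have hle : ∀ y ∈ l ++ [c], y ≤ x := by
        intro y hy
        rw [List.mem_append, List.mem_singleton] at hy
        rcases hy with hy | hy
        · exact hx y (List.mem_append_left _ hy)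
        · omega
      have hcons : (x :: (l ++ [c])).Pairwise (· ≥ ·) := List.pairwise_cons.2 ⟨hle, hsorted⟩
      have h1 : (l ++ [x + 1, c]).insertionSort (· ≥ ·) = (x + 1) :: (l ++ [c]) :=
        insertionSort_eq_of_perm List.perm_middle
          (List.pairwise_cons.2 ⟨fun y hy => (hle y hy).trans (Nat.le_succ x), hsorted⟩)
      have h2 : (x :: l ++ [x + 1, c]).insertionSort (· ≥ ·) = (x + 1) :: x :: (l ++ [c]) := by
        refine insertionSort_eq_of_perm (List.perm_middle (l₁ := x :: l)) (List.pairwise_cons.2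
          ⟨fun y hy => ?_, hcons⟩)
        rw [List.mem_cons] at hy
        rcases hy with hy | hy
        · omega
        · exact (hle y hy).trans (Nat.le_succ x)
      rw [h1, h2]
      exact Straightens.exchange x _

theorem rowLen_sortedPartition (l : List ℕ) (i : ℕ) (hi : i < l.length) :
    (sortedPartition l).rowLen i
      = (l.insertionSort (· ≥ ·))[i]'(by rwa [List.length_insertionSort]) :=
  YoungDiagram.rowLen_ofRowLens (hw := List.Pairwise.sortedGE (List.pairwise_insertionSort _ l))
    ⟨i, by rwa [List.length_insertionSort]⟩

theorem colLen_sortedPartition_le (l : List ℕ) : (sortedPartition l).colLen 0 ≤ l.length := by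
  by_contra h
  have h1 : (l.length, 0) ∈ sortedPartition l := YoungDiagram.mem_iff_lt_colLen.2 (not_le.1 h)
  rw [sortedPartition, YoungDiagram.mem_ofRowLens] at h1
  obtain ⟨h2, _⟩ := h1
  simp [List.length_insertionSort] at h2

theorem parts_sortedPartition (l : List ℕ) :
    parts (sortedPartition l) l.length = l.insertionSort (· ≥ ·) := by
  refine List.ext_getElem (by rw [length_parts, List.length_insertionSort]) fun i h1 h2 => ?_
  rw [length_parts] at h1
  simp only [parts, List.getElem_map, List.getElem_range]
  exact rowLen_sortedPartition l i h1

theorem listHL_sortedPartition (l : List ℕ) :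
    listHL (parts (sortedPartition l) ((sortedPartition l).colLen 0))
      = listHL (l.insertionSort (· ≥ ·)) := by
  rw [← listHL_parts _ (colLen_sortedPartition_le l), parts_sortedPartition]

theorem nStat_sortedPartition (l : List ℕ) :
    nStat (sortedPartition l) = listN (l.insertionSort (· ≥ ·)) := by
  rw [nStat_eq_listN _ (colLen_sortedPartition_le l), parts_sortedPartition]

/-! ### Coefficients of two-row Schur functions -/

theorem twoRowKostka_add (a b : ℕ) (f g : YPoly) :
    twoRowKostka a b (f + g) = twoRowKostka a b f + twoRowKostka a b g := by
  simp only [twoRowKostka, schurCoeff, MvPolynomial.coeff_add]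
  split_ifs <;> ring

theorem twoRowKostka_qY_pow_mul (a b k : ℕ) (f : YPoly) :
    twoRowKostka a b (qY ^ k * f) = Polynomial.X ^ k * twoRowKostka a b f := by
  have h : qY ^ k = MvPolynomial.C (Polynomial.X ^ k) := (map_pow _ _ _).symm
  simp only [twoRowKostka, schurCoeff, h, MvPolynomial.coeff_C_mul]
  split_ifs <;> ring

theorem coeff_y1_mul_y2_pow_mul (a c b : ℕ) (f : YPoly) :
    MvPolynomial.coeff (yExp a c) ((y1 * y2) ^ b * f)
      = if b ≤ a ∧ b ≤ c then MvPolynomial.coeff (yExp (a - b) (c - b)) f else 0 := by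
  have h : (y1 * y2) ^ b = MvPolynomial.monomial (yExp b b) (1 : ℤ[X]) := by
    rw [mul_pow, y1, y2, MvPolynomial.X_pow_eq_monomial, MvPolynomial.X_pow_eq_monomial,
      MvPolynomial.monomial_mul, one_mul, yExp]
  have hle : ∀ a b c d, yExp a b ≤ yExp c d ↔ a ≤ c ∧ b ≤ d := by
    intro a b c d
    rw [Finsupp.le_def]
    simp [Fin.forall_fin_two, yExp]
  rw [h, MvPolynomial.coeff_monomial_mul', one_mul]
  refine if_congr (hle _ _ _ _) ?_ rfl
  congr 1
  ext i
  fin_cases i <;> simp [yExp]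

/-- In two variables (y₁y₂)^b times a Schur polynomial adds b to both rows. -/
theorem twoRowKostka_y1_mul_y2_pow_mul {a c : ℕ} (hca : c ≤ a) (b : ℕ) (f : YPoly) :
    twoRowKostka a c ((y1 * y2) ^ b * f)
      = if b ≤ c then twoRowKostka (a - b) (c - b) f else 0 := by
  simp only [twoRowKostka, schurCoeff, coeff_y1_mul_y2_pow_mul]
  by_cases hbc : b ≤ c
  · rw [if_pos ⟨hbc.trans hca, hbc⟩, if_pos hbc]
    by_cases h : c - b = 0
    · rw [if_pos h]
      split_ifs <;> first | rfl | omega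
    · rw [if_neg h, if_neg (by omega), if_pos (by omega)]
      congr 3 <;> omega
  · rw [if_neg (by omega), if_neg hbc, if_neg (c := b ≤ a + 1 ∧ b ≤ c - 1) (by omega)]
    simp

/-- A factor q^k becomes q^{-k} under q ↦ 1/q and is absorbed by a difference k in the statistic n.
-/
theorem T_mul_invert_X_pow_mul (m k : ℕ) (p : ℤ[X]) :
    (LaurentPolynomial.T ((m + k : ℕ) : ℤ) : ℤ[T;T⁻¹]) *
        LaurentPolynomial.invert (Polynomial.toLaurent (Polynomial.X ^ k * p))
      = LaurentPolynomial.T (m : ℤ) * LaurentPolynomial.invert (Polynomial.toLaurent p) := by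
  rw [map_mul, Polynomial.toLaurent_X_pow, map_mul, LaurentPolynomial.invert_T, ← mul_assoc,
    ← LaurentPolynomial.T_add]
  congr 2
  push_cast
  ring

theorem T_mul_invert_X_pow_mul_of_eq {n m k : ℕ} (h : n = m + k) (p : ℤ[X]) :
    (LaurentPolynomial.T (n : ℤ) : ℤ[T;T⁻¹]) *
        LaurentPolynomial.invert (Polynomial.toLaurent (Polynomial.X ^ k * p))
      = LaurentPolynomial.T (m : ℤ) * LaurentPolynomial.invert (Polynomial.toLaurent p) := by
  rw [h, T_mul_invert_X_pow_mul]

/-! ### The recursion for two-row Kostka–Foulkes polynomials -/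

theorem parts_eq_append {mu : YoungDiagram} (hmu : 2 ≤ mu.colLen 0) :
    parts mu (mu.colLen 0) = (List.range (mu.colLen 0 - 2)).map mu.rowLen ++
      [mu.rowLen (mu.colLen 0 - 2), lastPart mu] := by
  obtain ⟨n, hn⟩ : ∃ n, mu.colLen 0 = n + 2 := ⟨mu.colLen 0 - 2, by omega⟩
  rw [lastPart, hn, parts_succ, parts_succ, parts, List.append_assoc]
  rfl

theorem pairwise_parts (mu : YoungDiagram) (N : ℕ) : (parts mu N).Pairwise (· ≥ ·) := by
  rw [parts, List.pairwise_map]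
  exact List.pairwise_lt_range.imp fun h => mu.rowLen_anti _ _ h.le

theorem lastPart_pos {mu : YoungDiagram} (hmu : 2 ≤ mu.colLen 0) : 0 < lastPart mu := by
  rw [lastPart, ← YoungDiagram.mem_iff_lt_rowLen, YoungDiagram.mem_iff_lt_colLen]
  omega

theorem lastPart_le {mu : YoungDiagram} : lastPart mu ≤ mu.rowLen (mu.colLen 0 - 2) :=
  mu.rowLen_anti _ _ (by omega)

theorem insertionSort_muMinus (mu : YoungDiagram) :
    ((List.range (mu.colLen 0 - 2)).map mu.rowLen ++
      [mu.rowLen (mu.colLen 0 - 2) - lastPart mu, 0]).insertionSort (· ≥ ·)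
      = (List.range (mu.colLen 0 - 2)).map mu.rowLen ++
        [mu.rowLen (mu.colLen 0 - 2) - lastPart mu, 0] := by
  refine List.Pairwise.insertionSort_eq ?_
  have h := pairwise_parts mu (mu.colLen 0 - 2 + 1)
  rw [parts_succ, parts, List.pairwise_append] at h
  rw [List.pairwise_append]
  refine ⟨h.1, by simp, fun x hx y hy => ?_⟩
  have := h.2.2 x hx _ (List.mem_singleton_self _)
  simp only [List.mem_cons, List.not_mem_nil, or_false] at hy
  omega

/-- The recursion for `Q'_μ` in two variables, with the change of the statistic `n`. -/
theorem listHL_recursion {mu : YoungDiagram} (hmu : 2 ≤ mu.colLen 0) :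
    ∃ k, nStat mu = nStat (muPlus mu) + k ∧
      listHL (parts mu (mu.colLen 0))
        = qY ^ k * listHL (parts (muPlus mu) ((muPlus mu).colLen 0))
          + qY ^ ((mu.colLen 0 - 2) * lastPart mu) * ((y1 * y2) ^ lastPart mu *
            listHL (parts (muMinus mu) ((muMinus mu).colLen 0))) := by
  set n := mu.colLen 0 with hn
  set l := (List.range (n - 2)).map mu.rowLen with hl
  set a := mu.rowLen (n - 2) with ha
  set b := lastPart mu with hb
  have hlen : l.length = n - 2 := by rw [hl, List.length_map, List.length_range]
  have hbpos : 0 < b := lastPart_pos hmu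
  have hba : b ≤ a := lastPart_le
  have hla : l ++ [a] = parts mu (n - 2 + 1) := by rw [parts_succ]; rfl
  obtain ⟨_, k, hk, hnk⟩ := straightens_insertionSort (a := a) (c := b - 1) (by omega) l
    (by rw [hla]; exact pairwise_parts _ _)
  have hminus := insertionSort_muMinus mu
  -- One unit comes from moving a cell of the last part up one row, the other k from sorting.
  refine ⟨k + 1, ?_, ?_⟩
  · rw [nStat_eq_listN mu le_rfl, parts_eq_append hmu, muPlus, nStat_sortedPartition]
    have h1 : l ++ [a, b] = (l ++ [a]) ++ [b] := by simp
    have h2 : l ++ [a + 1, b - 1] = (l ++ [a + 1]) ++ [b - 1] := by simp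
    have h3 : listN (l ++ [a, b]) = listN (l ++ [a + 1, b - 1]) + 1 := by
      rw [h1, h2, listN_append_singleton, listN_append_singleton, listN_append_singleton,
        listN_append_singleton]
      obtain ⟨c, hc⟩ : ∃ c, b = c + 1 := ⟨b - 1, by omega⟩
      simp only [List.length_append, List.length_singleton, hc, Nat.add_sub_cancel]
      ring
    change listN (l ++ [a, b]) = listN ((l ++ [a + 1, b - 1]).insertionSort (· ≥ ·)) + (k + 1)
    omega
  · rw [parts_eq_append hmu, muPlus, muMinus, listHL_sortedPartition, listHL_sortedPartition]
    change listHL (l ++ [a, b]) = qY ^ (k + 1) *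
      listHL ((l ++ [a + 1, b - 1]).insertionSort (· ≥ ·)) + qY ^ ((n - 2) * b) * ((y1 * y2) ^ b *
        listHL ((l ++ [a - b, 0]).insertionSort (· ≥ ·)))
    have h1 : l ++ [a - b, 0] = (l ++ [a - b]) ++ [0] := by simp
    rw [listHL_append_pair l hbpos hba, hk, hminus, h1, listHL_append_zero, hlen]
    ring

/-- Both of the last two parts lose μ_n. The share (n - 2)μ_n cancels the power of q in
`listHL_recursion`; the share (n - 1)μ_n remains in the theorem. -/
theorem nStat_eq_nStat_muMinus_add {mu : YoungDiagram} (hmu : 2 ≤ mu.colLen 0) :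
    nStat mu = (mu.colLen 0 - 1) * lastPart mu + nStat (muMinus mu)
      + (mu.colLen 0 - 2) * lastPart mu := by
  rw [nStat_eq_listN mu le_rfl, parts_eq_append hmu, muMinus, nStat_sortedPartition,
    insertionSort_muMinus]
  have h : ∀ (l : List ℕ) (x y : ℕ), l ++ [x, y] = (l ++ [x]) ++ [y] := by simp
  obtain ⟨d, hd⟩ : ∃ d, mu.rowLen (mu.colLen 0 - 2) = lastPart mu + d :=
    ⟨_, (Nat.add_sub_of_le lastPart_le).symm⟩
  obtain ⟨m, hm⟩ : ∃ m, mu.colLen 0 = m + 2 := ⟨mu.colLen 0 - 2, by omega⟩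
  rw [h, h, listN_append_singleton, listN_append_singleton, listN_append_singleton,
    listN_append_singleton, hd, hm]
  simp only [List.length_append, List.length_singleton, List.length_map, List.length_range,
    Nat.add_sub_cancel, Nat.add_sub_cancel_left]
  have : m + 2 - 1 = m + 1 := by omega
  rw [this]
  ring

theorem sortedPartition_pair {c d : ℕ} (h : d ≤ c) : (sortedPartition [c, d]).colLen 0 ≤ 2 ∧
    (sortedPartition [c, d]).rowLen 0 = c ∧ (sortedPartition [c, d]).rowLen 1 = d := by
  have hs : [c, d].insertionSort (· ≥ ·) = [c, d] := List.Pairwise.insertionSort_eq (by simpa)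
  have hp := parts_sortedPartition [c, d]
  rw [hs] at hp
  have hp' : [(sortedPartition [c, d]).rowLen 0, (sortedPartition [c, d]).rowLen 1] = [c, d] := hp
  simp only [List.cons.injEq, and_true] at hp'
  exact ⟨colLen_sortedPartition_le [c, d], hp'⟩

end

end KostkaFoulkes

theorem theorem3p1 (lam mu : YoungDiagram) (hlam : lam.colLen 0 ≤ 2) (hmu : 2 ≤ mu.colLen 0) :
    KostkaFoulkes.cochargeKostka lam mu =
      KostkaFoulkes.cochargeKostka lam (KostkaFoulkes.muPlus mu) +
      LaurentPolynomial.T (((mu.colLen 0 - 1) * KostkaFoulkes.lastPart mu : ℕ) : ℤ) *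
        KostkaFoulkes.cochargeKostkaPair
          ((lam.rowLen 0 : ℤ) - (KostkaFoulkes.lastPart mu : ℤ))
          ((lam.rowLen 1 : ℤ) - (KostkaFoulkes.lastPart mu : ℤ))
          (KostkaFoulkes.muMinus mu) := by
  open KostkaFoulkes in
  have hle : lam.rowLen 1 ≤ lam.rowLen 0 := lam.rowLen_anti 0 1 zero_le_one
  have hpair : ∀ c d : ℤ, 0 ≤ d ∧ d ≤ c → d.toNat ≤ c.toNat := fun c d h => Int.toNat_le_toNat h.2
  rcases kostkaFoulkes_twoRow with hK | hK
  -- Degenerate alternative: every term vanishes.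
  · rw [cochargeKostka, cochargeKostka, cochargeKostkaPair, hK lam mu hlam, hK lam _ hlam]
    split_ifs with h
    · rw [cochargeKostka, hK _ _ (sortedPartition_pair (hpair _ _ h)).1]
      simp
    · simp
  · obtain ⟨k, hk, hrec⟩ := listHL_recursion hmu
    rw [cochargeKostka, cochargeKostka, hK lam mu hlam, hK lam _ hlam, hrec, twoRowKostka_add,
      twoRowKostka_qY_pow_mul, twoRowKostka_qY_pow_mul, map_add, map_add, mul_add,
      T_mul_invert_X_pow_mul_of_eq hk, twoRowKostka_y1_mul_y2_pow_mul hle,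
      T_mul_invert_X_pow_mul_of_eq (nStat_eq_nStat_muMinus_add hmu)]
    congr 1
    rw [cochargeKostkaPair, Nat.cast_add, LaurentPolynomial.T_add, mul_assoc]
    congr 1
    -- If λ₂ < μ_n, multiplication by (y₁y₂)^{μ_n} leaves no s_λ term, in agreement with the
    -- convention for a pair that is not a partition.
    by_cases hb : lastPart mu ≤ lam.rowLen 1
    · have h1 : ((lam.rowLen 0 : ℤ) - (lastPart mu : ℤ)).toNat = lam.rowLen 0 - lastPart mu := by
        omega
      have h2 : ((lam.rowLen 1 : ℤ) - (lastPart mu : ℤ)).toNat = lam.rowLen 1 - lastPart mu := by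
        omega
      obtain ⟨hs, hs0, hs1⟩ := sortedPartition_pair
        (show lam.rowLen 1 - lastPart mu ≤ lam.rowLen 0 - lastPart mu by omega)
      rw [if_pos hb, if_pos (by omega), h1, h2, cochargeKostka, hK _ _ hs, hs0, hs1]
    · rw [if_neg hb, if_neg (by omega), map_zero, map_zero, mul_zero]
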